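/- Let $\xi_j$, $j\in\mathbb Z$, be real random variables such that $\Xi=\sum_{j\in\mathbb Z}\delta_{\xi_j}$ is a homogeneous Poisson process on $\mathbb R$ with rate $\lambda\in(0,\infty)$, and let $W^{(j)}$, $j\in\mathbb Z$, be independent standard one-dimensional Brownian motions, jointly independent of $(\xi_j)_{j\in\mathbb Z}$. For $r>0$ and $\sigma>0$ let $$N(t)=\sum_{j\in\mathbb Z}\mathbf 1\{\xi_j+\sigma W^{(j)}_t\in[-r,r]\},\qquad t\ge 0,$$ be the Smoluchowski process with Brownian displacement, observed on $[0,T]$, and put $\rho=\mathbb E N(t)=2r\lambda$. For $0\le t<T$ let $$\hat R(t)=\frac1{T-t}\int_0^{T-t}[N(s)-\rho][N(s+t)-\rho]\,ds ,$$ let $\hat H(t)$ be either the unbiased estimator $\hat R(t)/\rho$ or its truncated version $\max\{\hat R(t),0\}/\rho$ of the correlation function of $N$, and for $\tau>0$ define $$\hat\sigma_\tau=\frac{\sqrt{2\pi}\,r}{\sqrt\tau}\,\bigl[1-\hat H(\tau)\bigr].$$ Then there is an absolute constant $c>0$ such that for all $r>0$ and $\bar\sigma>0$ there is $T_0=T_0(r,\bar\sigma)$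 such that for all $T\ge T_0$, all $\sigma\in(0,\bar\sigma]$ and all $\lambda>0$, with $\tau_*=4r^2/(\bar\sigma^2\ln T)$ (and for either choice of $\hat H$), the estimator $\hat\sigma_{\tau_*}$ is square integrable and $$\mathbb E\bigl|\hat\sigma_{\tau_*}-\sigma\bigr|^2\le c\Bigl(1+\frac1\rho\Bigr)\Bigl(\frac r\sigma\Bigr)\frac{\bar\sigma^2\ln T}{\sqrt T}.$$ -/

import Mathlib

open MeasureTheory ProbabilityTheory
open scoped NNReal ENNReal

universe u

noncomputable section

namespace Smoluchowski

variable {Ω : Type*} [MeasurableSpace Ω]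

/-- The point process `∑_{j ∈ ℤ} δ_{ξ_j}` on the real line. -/
def pointProcess (ξ : ℤ → Ω → ℝ) (ω : Ω) : Measure ℝ :=
  Measure.sum fun j : ℤ => Measure.dirac (ξ j ω)

/-- `∑_{j ∈ ℤ} δ_{ξ_j}` is a homogeneous Poisson process on `ℝ` with rate `lam`: the number of
points in a Borel set `A` of finite length has the Poisson distribution with mean `lam * |A|`,
and the numbers of points in pairwise disjoint Borel sets are independent. -/
structure IsHomogeneousPoisson (ξ : ℤ → Ω → ℝ) (lam : ℝ≥0) (P : Measure Ω) : Prop where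
  measurable : ∀ j, Measurable (ξ j)
  hasLaw_count : ∀ A : Set ℝ, MeasurableSet A → volume A < ∞ →
    HasLaw (fun ω => pointProcess ξ ω A)
      ((poissonMeasure (lam * (volume A).toNNReal)).map (fun n : ℕ => (n : ℝ≥0∞))) P
  indep_count : ∀ (n : ℕ) (A : Fin n → Set ℝ), (∀ i, MeasurableSet (A i)) →
    Pairwise (Function.onFun Disjoint A) →
    iIndepFun (fun (i : Fin n) (ω : Ω) => pointProcess ξ ω (A i)) P

/-- Particles on the real line with initial positions `ξ j` forming a homogeneous Poisson process
of rate `lam`, driven by independent standard Brownian motions `W j`, which are jointly independent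
of the initial positions. -/
structure IsBrownianParticleSystem (ξ : ℤ → Ω → ℝ) (W : ℤ → ℝ≥0 → Ω → ℝ) (lam : ℝ≥0)
    (P : Measure Ω) : Prop where
  poisson : IsHomogeneousPoisson ξ lam P
  measurable : ∀ j t, Measurable (W j t)
  brownian : ∀ j, IsBrownianReal (W j) P
  indep : iIndepFun (fun (j : ℤ) (ω : Ω) (t : ℝ≥0) => W j t ω) P
  indep_init : IndepFun (fun (ω : Ω) (j : ℤ) => ξ j ω)
    (fun (ω : Ω) (j : ℤ) (t : ℝ≥0) => W j t ω) P

/-- The position at time `t` of the `j`-th particle, `X_t^{(j)} = ξ_j + σ W_t^{(j)}`. -/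
def position (ξ : ℤ → Ω → ℝ) (W : ℤ → ℝ≥0 → Ω → ℝ) (σ : ℝ) (j : ℤ) (t : ℝ≥0) (ω : Ω) : ℝ :=
  ξ j ω + σ * W j t ω

/-- The Smoluchowski process `N(t) = ∑_j 1{X_t^{(j)} ∈ B}` with observation region the closed
Euclidean ball `B = [-r, r]`, as the path `t ↦ N(t)` attached to an outcome `ω`.
Almost surely the sum is finite for all `t` simultaneously. -/
def count (ξ : ℤ → Ω → ℝ) (W : ℤ → ℝ≥0 → Ω → ℝ) (r σ : ℝ) (ω : Ω) (t : ℝ≥0) : ℝ :=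
  (∑' j : ℤ, (Metric.closedBall (0 : ℝ) r).indicator (fun _ => (1 : ℝ≥0∞))
    (position ξ W σ j t ω)).toReal

/-- `ρ = lam * vol(B)`, the mean of `N(t)`. -/
def meanCount (lam : ℝ≥0) (r : ℝ) : ℝ :=
  lam * volume.real (Metric.closedBall (0 : ℝ) r)

/-- The covariance estimator
`R̂(t) = (T - t)⁻¹ ∫_0^{T-t} (N(s) - ρ) (N(s + t) - ρ) ds` computed from a path `N` on `[0, T]`. -/
def covEstimator (ρ T : ℝ) (N : ℝ≥0 → ℝ) (t : ℝ) : ℝ :=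
  1 / (T - t) * ∫ s in (0 : ℝ)..(T - t), (N s.toNNReal - ρ) * (N (s + t).toNNReal - ρ)

/-- The (unbiased) correlation estimator `R̂(t) / ρ`. -/
def corrEstimator (ρ T : ℝ) (N : ℝ≥0 → ℝ) (t : ℝ) : ℝ :=
  covEstimator ρ T N t / ρ

/-- The truncated correlation estimator `max (R̂(t)) 0 / ρ`. -/
def corrEstimatorPos (ρ T : ℝ) (N : ℝ≥0 → ℝ) (t : ℝ) : ℝ :=
  max (covEstimator ρ T N t) 0 / ρ

/-- The estimator `√(2π) r τ^{-1/2} (1 - Ĥ(τ))` of the diffusion coefficient, built from an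
estimator `H` of the correlation function. -/
def sigmaEstimator (r : ℝ) (H : ℝ → ℝ) (τ : ℝ) : ℝ :=
  √(2 * Real.pi) * r / √τ * (1 - H τ)

/-- The time lag `τ_* = 4 r² / (σ̄² ln T)`. -/
def tauStar (r σbar T : ℝ) : ℝ :=
  4 * r ^ 2 / (σbar ^ 2 * Real.log T)

end Smoluchowski

end

/-! The error splits into a stochastic part, from estimating the covariance `C(v) = lam * overlap r
σ v` of `N`, and a bias, from linearising `C` at lag `τ_*`.

Stochastic part. Marking each Poisson point with the values of its Brownian path at finitely many
times gives a Poisson process on a product space, with intensity `M = lam dx ⊗ Q`, and `N(t_i)`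
counts its points in a set `A_i`. Splitting according to which `A_i` contain a point writes the
counts as sums of independent Poisson variables (`IsMarkedPoisson.map_markCount`), so all joint
cumulants are masses of intersections: the second is `M(A_i ∩ A_j) = C(|t_i - t_j|)`, the fourth is
`M(A_i ∩ A_j ∩ A_k ∩ A_l)`, at most `C(|t_i - t_k|)`. The variance of the covariance estimator is
then controlled by averages of `C`. In dimension one `C(v) ≤ D / √v` with `D = 2ρr/σ`, and
integrating this over a window of length `T` leaves order `D √T / T`
(`IsStationaryFourth.variance_le`).

Bias. `overlap r σ v` is the mean of the positive part of `2r - σ|y|` for a Gaussian `y` of variance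
`v`. Without the positive part the mean is `2r - σ √(2v/π)`, from which the estimator would recover
`σ` exactly; the positive part matters only when `|y| > 2r/σ`, which costs a factor
`exp(-(2r/σ)²/(2v))`. The lag `τ_*` makes this at most `1/√T` for every `σ ≤ σbar`, while the
stochastic error is amplified only by `A² = (π/2) σbar² ln T` (`bias_bounds`). The squared bias
`σ²/T` is of lower order once `T` is large. -/

namespace Smoluchowski

open Filter Topology

/-! ### Laplace functional of the Poisson process -/

section

/-- The function `x ↦ e^{-x}` on `[0, ∞]`. -/
noncomputable def expNeg (x : ℝ≥0∞) : ℝ≥0∞ := EReal.exp (-(x : EReal))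

@[simp] lemma expNeg_zero : expNeg 0 = 1 := by simp [expNeg]

lemma continuous_expNeg : Continuous expNeg :=
  ENNReal.continuous_exp.comp (continuous_neg.comp continuous_coe_ennreal_ereal)

lemma measurable_expNeg : Measurable expNeg := continuous_expNeg.measurable

lemma antitone_expNeg : Antitone expNeg := fun _ _ h =>
  EReal.exp_monotone (EReal.neg_le_neg_iff.2 (EReal.coe_ennreal_le_coe_ennreal_iff.2 h))

lemma expNeg_le_one (x : ℝ≥0∞) : expNeg x ≤ 1 := by
  simpa using antitone_expNeg (zero_le (a := x))

lemma expNeg_ne_top (x : ℝ≥0∞) : expNeg x ≠ ∞ := ((expNeg_le_one x).trans_lt ENNReal.one_lt_top).ne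

lemma expNeg_coe (x : ℝ≥0) : expNeg x = ENNReal.ofReal (Real.exp (-x)) := by
  rw [expNeg, EReal.coe_nnreal_eq_coe_real, ← EReal.coe_neg, EReal.exp_coe]

lemma expNeg_add (x y : ℝ≥0∞) : expNeg (x + y) = expNeg x * expNeg y := by
  rw [expNeg, expNeg, expNeg, ← EReal.exp_add, EReal.coe_ennreal_add, EReal.neg_add]
  · rw [sub_eq_add_neg]
  · left; simp
  · right; simp

lemma expNeg_sum {ι : Type*} (s : Finset ι) (f : ι → ℝ≥0∞) :
    expNeg (∑ i ∈ s, f i) = ∏ i ∈ s, expNeg (f i) := by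
  classical
  induction s using Finset.induction_on with
  | empty => simp
  | insert a s ha ih => rw [Finset.sum_insert ha, Finset.prod_insert ha, expNeg_add, ih]

lemma expNeg_mul_natCast (c : ℝ≥0∞) (n : ℕ) : expNeg (c * n) = expNeg c ^ n := by
  have := expNeg_sum (Finset.range n) fun _ => c
  simpa [mul_comm] using this

/-- Every number in `[0, 1]` is some `e^{-f}`, with `f = ∞` for `0`. This lets an averaged weight be
absorbed into a test function of the Laplace functional. -/
lemma exists_expNeg_eq {y : ℝ≥0∞} (hy : y ≤ 1) : expNeg ((-ENNReal.log y).toENNReal) = y := by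
  rw [expNeg, EReal.coe_toENNReal, neg_neg, ENNReal.exp_log]
  rw [EReal.le_neg, neg_zero]
  exact ENNReal.log_le_zero_iff.2 hy

/-- With `q = e^{-c}` this is the exponential series in `m q`; `c = ∞` is covered by `q = 0`. -/
lemma lintegral_expNeg_mul_poissonMeasure (m : ℝ≥0) (c : ℝ≥0∞) :
    ∫⁻ n : ℕ, expNeg (c * n) ∂(poissonMeasure m) = expNeg (m * (1 - expNeg c)) := by
  obtain ⟨q, hq⟩ : ∃ q : ℝ≥0, (q : ℝ≥0∞) = expNeg c :=
    ⟨_, ENNReal.coe_toNNReal (expNeg_ne_top c)⟩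
  have hq1 : q ≤ 1 := by
    have := expNeg_le_one c
    rw [← hq] at this
    exact_mod_cast this
  have h1 : (m : ℝ≥0∞) * (1 - expNeg c) = ((m * (1 - q) : ℝ≥0) : ℝ≥0∞) := by
    rw [← hq]; push_cast; rfl
  rw [h1, expNeg_coe, poissonMeasure, lintegral_sum_measure]
  simp_rw [lintegral_smul_measure, lintegral_dirac, expNeg_mul_natCast, ← hq, smul_eq_mul]
  have h2 : ∀ n : ℕ, ENNReal.ofReal (Real.exp (-m) * m ^ n / n.factorial) * (q : ℝ≥0∞) ^ n
      = ENNReal.ofReal (Real.exp (-m) * ((m * q : ℝ) ^ n / n.factorial)) := by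
    intro n
    rw [← ENNReal.coe_pow, ← ENNReal.ofReal_coe_nnreal, ← ENNReal.ofReal_mul (by positivity)]
    congr 1
    push_cast
    ring
  simp_rw [h2]
  have h3 := (NormedSpace.expSeries_div_hasSum_exp (m * q : ℝ)).mul_left (Real.exp (-m))
  rw [← ENNReal.ofReal_tsum_of_nonneg (fun n => by positivity) h3.summable, h3.tsum_eq,
    ← Real.exp_eq_exp_ℝ, ← Real.exp_add]
  congr 2
  push_cast [NNReal.coe_sub hq1]
  ring

lemma lintegral_pointProcess {Ω : Type*} (ξ : ℤ → Ω → ℝ) (ω : Ω) {f : ℝ → ℝ≥0∞} (hf : Measurable f) :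
    ∫⁻ x, f x ∂(pointProcess ξ ω) = ∑' j, f (ξ j ω) := by
  rw [pointProcess, lintegral_sum_measure]
  exact tsum_congr fun j => lintegral_dirac' _ hf

variable {Ω : Type*} [MeasurableSpace Ω] {P : Measure Ω} {ξ : ℤ → Ω → ℝ} {lam : ℝ≥0}

lemma IsHomogeneousPoisson.measurable_lintegral (h : IsHomogeneousPoisson ξ lam P)
    {f : ℝ → ℝ≥0∞} (hf : Measurable f) :
    Measurable fun ω => ∫⁻ x, f x ∂(pointProcess ξ ω) := by
  simp_rw [lintegral_pointProcess ξ _ hf]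
  exact Measurable.tsum fun j => hf.comp (h.measurable j)

lemma IsHomogeneousPoisson.measurable_count (h : IsHomogeneousPoisson ξ lam P)
    {A : Set ℝ} (hA : MeasurableSet A) : Measurable fun ω => pointProcess ξ ω A := by
  simpa [hA] using h.measurable_lintegral (measurable_one.indicator hA)

lemma IsHomogeneousPoisson.lintegral_expNeg_count (h : IsHomogeneousPoisson ξ lam P)
    {A : Set ℝ} (hA : MeasurableSet A) (hA' : volume A < ∞) (c : ℝ≥0∞) :
    ∫⁻ ω, expNeg (c * pointProcess ξ ω A) ∂P = expNeg (lam * ((1 - expNeg c) * volume A)) := by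
  have hm : Measurable fun x : ℝ≥0∞ => expNeg (c * x) :=
    measurable_expNeg.comp (measurable_const_mul c)
  have := (h.hasLaw_count A hA hA').lintegral_comp (f := fun x => expNeg (c * x)) hm.aemeasurable
  rw [this, lintegral_map hm (by fun_prop), lintegral_expNeg_mul_poissonMeasure]
  rw [ENNReal.coe_mul, ENNReal.coe_toNNReal hA'.ne]
  ring_nf

/-- Counts in the disjoint level sets are independent Poisson, so the expectation factorises. The
level set of the value `0` may be infinite but contributes nothing to either side. -/
lemma IsHomogeneousPoisson.lintegral_expNeg_simpleFunc (h : IsHomogeneousPoisson ξ lam P)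
    (f : SimpleFunc ℝ ℝ≥0∞) (hf : ∀ c, c ≠ 0 → volume (f ⁻¹' {c}) < ∞) :
    ∫⁻ ω, expNeg (∫⁻ x, f x ∂(pointProcess ξ ω)) ∂P
      = expNeg (lam * ∫⁻ x, (1 - expNeg (f x))) := by
  classical
  set s := f.range.filter (· ≠ 0)
  let e := s.equivFin
  let A : Fin s.card → Set ℝ := fun i => f ⁻¹' {(e.symm i : ℝ≥0∞)}
  have hA : ∀ i, MeasurableSet (A i) := fun i => f.measurableSet_preimage _
  have hAv : ∀ i, volume (A i) < ∞ := fun i => hf _ (Finset.mem_filter.1 (e.symm i).2).2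
  have hsum : ∀ (μ : Measure ℝ) (g : ℝ≥0∞ → ℝ≥0∞), g 0 = 0 →
      ∑ x ∈ f.range, g x * μ (f ⁻¹' {x}) = ∑ i, g (e.symm i) * μ (A i) := by
    intro μ g hg
    rw [← Finset.sum_filter_of_ne (p := (· ≠ 0)) (fun x _ hx hx0 => hx (by simp [hx0, hg])),
      ← Finset.sum_coe_sort]
    exact (Equiv.sum_comp e.symm fun x : s => g x * μ (f ⁻¹' {(x : ℝ≥0∞)})).symm
  have h1 : ∀ ω, ∫⁻ x, f x ∂(pointProcess ξ ω) = ∑ i, (e.symm i : ℝ≥0∞) * pointProcess ξ ω (A i) := by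
    intro ω
    rw [f.lintegral_eq_lintegral, SimpleFunc.lintegral]
    exact hsum _ id rfl
  have h2 : ∫⁻ x, (1 - expNeg (f x)) = ∑ i, (1 - expNeg (e.symm i)) * volume (A i) := by
    rw [← hsum volume (fun x => 1 - expNeg x) (by simp),
      ← SimpleFunc.map_lintegral (fun x => 1 - expNeg x) f, ← SimpleFunc.lintegral_eq_lintegral]
    rfl
  have hdis : Pairwise (Function.onFun Disjoint A) := by
    intro i j hij
    refine Set.disjoint_left.2 fun x hx hx' => hij ?_
    have : (e.symm i : ℝ≥0∞) = e.symm j := by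
      rw [← Set.mem_singleton_iff.1 hx, ← Set.mem_singleton_iff.1 hx']
    exact e.symm.injective (Subtype.ext this)
  have hind := (h.indep_count _ A hA hdis).comp (fun i x => expNeg ((e.symm i : ℝ≥0∞) * x))
    (fun i => measurable_expNeg.comp (measurable_const_mul _))
  simp_rw [h1, h2, expNeg_sum, Finset.mul_sum, expNeg_sum]
  have := lintegral_prod_eq_prod_lintegral_of_indepFun Finset.univ _ hind
    (fun i => (measurable_expNeg.comp (measurable_const_mul _)).comp (h.measurable_count (hA i)))
  simp only [Function.comp_apply] at this
  rw [this]
  exact Finset.prod_congr rfl fun i _ => h.lintegral_expNeg_count (hA i) (hAv i) _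

/-- The Laplace functional of a homogeneous Poisson process. -/
theorem IsHomogeneousPoisson.lintegral_expNeg [IsProbabilityMeasure P]
    (h : IsHomogeneousPoisson ξ lam P) {f : ℝ → ℝ≥0∞} (hf : Measurable f) :
    ∫⁻ ω, expNeg (∑' j, f (ξ j ω)) ∂P = expNeg (lam * ∫⁻ x, (1 - expNeg (f x))) := by
  -- Restriction to `[-n, n]` gives the nonzero level sets finite length and keeps the approximation
  -- monotone.
  let F : ℕ → SimpleFunc ℝ ℝ≥0∞ := fun n =>
    (SimpleFunc.eapprox f n).restrict (Set.Icc (-n : ℝ) n)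
  have hFapp : ∀ n x, F n x = (Set.Icc (-n : ℝ) n).indicator (SimpleFunc.eapprox f n) x :=
    fun n x => SimpleFunc.restrict_apply _ measurableSet_Icc x
  have hmono : ∀ x, Monotone fun n => F n x := by
    intro x n m hnm
    simp only [hFapp]
    refine (Set.indicator_le_indicator_of_subset (t := Set.Icc (-m : ℝ) m) ?_ (fun _ => zero_le) x).trans
      (Set.indicator_le_indicator (SimpleFunc.monotone_eapprox f hnm x))
    have : (n : ℝ) ≤ m := by exact_mod_cast hnm
    exact Set.Icc_subset_Icc (by linarith) this
  have hlim : ∀ x, Tendsto (fun n => F n x) atTop (𝓝 (f x)) := by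
    intro x
    have h1 : Tendsto (fun n => SimpleFunc.eapprox f n x) atTop (𝓝 (f x)) := by
      rw [← SimpleFunc.iSup_eapprox_apply hf x]
      exact tendsto_atTop_iSup fun n m hnm => SimpleFunc.monotone_eapprox f hnm x
    obtain ⟨N, hN⟩ := exists_nat_ge |x|
    refine h1.congr' ?_
    filter_upwards [eventually_ge_atTop N] with n hn
    have hn' : |x| ≤ n := hN.trans (by exact_mod_cast hn)
    rw [hFapp, Set.indicator_of_mem (Set.mem_Icc.2 (abs_le.1 hn'))]
  have hfin : ∀ n c, c ≠ 0 → volume (F n ⁻¹' {c}) < ∞ := by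
    intro n c hc
    refine lt_of_le_of_lt (measure_mono (t := Set.Icc (-n : ℝ) n) ?_) (by simp)
    intro x hx
    by_contra hx'
    apply hc
    rw [← Set.mem_singleton_iff.1 hx, hFapp, Set.indicator_of_notMem hx']
  have hL : Tendsto (fun n => ∫⁻ ω, expNeg (∫⁻ x, F n x ∂(pointProcess ξ ω)) ∂P) atTop
      (𝓝 (∫⁻ ω, expNeg (∫⁻ x, f x ∂(pointProcess ξ ω)) ∂P)) := by
    refine tendsto_lintegral_of_dominated_convergence (fun _ => 1)
      (fun n => measurable_expNeg.comp (h.measurable_lintegral (F n).measurable))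
      (fun n => ae_of_all _ fun ω => expNeg_le_one _) (by simp) (ae_of_all _ fun ω => ?_)
    refine (continuous_expNeg.tendsto _).comp ?_
    exact lintegral_tendsto_of_tendsto_of_monotone (fun n => (F n).measurable.aemeasurable)
      (ae_of_all _ hmono) (ae_of_all _ hlim)
  have hR : Tendsto (fun n => expNeg (lam * ∫⁻ x, (1 - expNeg (F n x)))) atTop
      (𝓝 (expNeg (lam * ∫⁻ x, (1 - expNeg (f x))))) := by
    refine (continuous_expNeg.tendsto _).comp (ENNReal.Tendsto.const_mul ?_ (.inr (by simp)))
    refine lintegral_tendsto_of_tendsto_of_monotone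
      (fun n => (measurable_const.sub (measurable_expNeg.comp (F n).measurable)).aemeasurable)
      (ae_of_all _ fun x n m hnm => tsub_le_tsub_left (antitone_expNeg (hmono x hnm)) _)
      (ae_of_all _ fun x => ?_)
    exact ENNReal.Tendsto.sub tendsto_const_nhds ((continuous_expNeg.tendsto _).comp (hlim x))
      (.inl (by simp))
  simp_rw [← lintegral_pointProcess ξ _ hf]
  refine tendsto_nhds_unique hL (hR.congr fun n => ?_)
  exact (h.lintegral_expNeg_simpleFunc (F n) (hfin n)).symm

end

/-! ### Uniqueness of the multivariate Laplace transform -/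

section LaplaceUniqueness

variable {ι : Type*} [Fintype ι]

open BoundedContinuousFunction in
/-- The bounded continuous function `x ↦ exp (-∑ i, u i * x i)` on the nonnegative orthant. -/
noncomputable def laplaceKernel (u : ι → ℝ≥0) : (ι → ℝ≥0) →ᵇ ℝ :=
  BoundedContinuousFunction.ofNormedAddCommGroup
    (fun x => Real.exp (-((∑ i, u i * x i : ℝ≥0) : ℝ))) (by fun_prop) 1 (fun x => by
      rw [Real.norm_eq_abs, Real.abs_exp]
      exact Real.exp_le_one_iff.2 (neg_nonpos.2 (NNReal.coe_nonneg _)))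

lemma laplaceKernel_apply (u x : ι → ℝ≥0) :
    laplaceKernel u x = Real.exp (-((∑ i, u i * x i : ℝ≥0) : ℝ)) := rfl

/-- The kernels of the Laplace transform as a multiplicative family. -/
noncomputable def laplaceKernelHom :
    Multiplicative (ι → ℝ≥0) →* BoundedContinuousFunction (ι → ℝ≥0) ℝ where
  toFun u := laplaceKernel u.toAdd
  map_one' := by
    ext x
    simp [laplaceKernel_apply]
  map_mul' u v := by
    ext x
    simp [laplaceKernel_apply, ← Real.exp_add, add_mul, Finset.sum_add_distrib, add_comm]

/-- A finite measure on the nonnegative orthant is determined by its Laplace transform. -/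
theorem ext_of_lintegral_expNeg {μ ν : Measure (ι → ℝ≥0)} [IsFiniteMeasure μ] [IsFiniteMeasure ν]
    (h : ∀ u : ι → ℝ≥0, ∫⁻ x, expNeg (∑ i, (u i : ℝ≥0∞) * x i) ∂μ
      = ∫⁻ x, expNeg (∑ i, (u i : ℝ≥0∞) * x i) ∂ν) : μ = ν := by
  classical
  -- A point-separating star subalgebra of bounded continuous functions determines a finite measure
  -- on a Polish space.
  let A : Subalgebra ℝ (BoundedContinuousFunction (ι → ℝ≥0) ℝ) :=
    Algebra.adjoin ℝ (MonoidHom.mrange (laplaceKernelHom (ι := ι)) : Set _)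
  let S : StarSubalgebra ℝ (BoundedContinuousFunction (ι → ℝ≥0) ℝ) :=
    { A with star_mem' := fun {a} ha =>
        (BoundedContinuousFunction.ext fun _ => star_trivial _ : star a = a).symm ▸ ha }
  have hker : ∀ (u : ι → ℝ≥0) (ρ : Measure (ι → ℝ≥0)), ∫ x, laplaceKernel u x ∂ρ
      = (∫⁻ x, expNeg (∑ i, (u i : ℝ≥0∞) * x i) ∂ρ).toReal := by
    intro u ρ
    rw [integral_eq_lintegral_of_nonneg_ae (f := laplaceKernel u)
      (ae_of_all _ fun x => (Real.exp_pos _).le)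
      (laplaceKernel u).continuous.aestronglyMeasurable]
    congr 2 with x
    rw [laplaceKernel_apply, ← expNeg_coe]
    push_cast
    rfl
  refine ext_of_forall_mem_subalgebra_integral_eq_of_polish (A := S) (𝕜 := ℝ) ?_ ?_
  · intro x y hxy
    obtain ⟨i, hi⟩ := Function.ne_iff.1 hxy
    refine ⟨_, ⟨_, ⟨laplaceKernel (Pi.single i 1), ?_, rfl⟩, rfl⟩, ?_⟩
    · exact Algebra.subset_adjoin ⟨Multiplicative.ofAdd (Pi.single i 1), rfl⟩
    · have : ∀ z : ι → ℝ≥0, laplaceKernel (Pi.single i 1) z = Real.exp (-(z i)) := by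
        intro z
        simp [laplaceKernel_apply, Pi.single_apply]
      change laplaceKernel (Pi.single i 1) x ≠ laplaceKernel (Pi.single i 1) y
      rw [this, this]
      simpa using hi
  · intro g hg
    have hg' : g ∈ Subalgebra.toSubmodule A := hg
    -- The kernels are closed under products, so the algebra is their linear span and linearity
    -- suffices.
    rw [Algebra.adjoin_eq_span, Submonoid.closure_eq] at hg'
    clear hg
    induction hg' using Submodule.span_induction with
    | mem g hg =>
      obtain ⟨u, rfl⟩ := hg
      change ∫ x, laplaceKernel u.toAdd x ∂μ = ∫ x, laplaceKernel u.toAdd x ∂ν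
      rw [hker, hker, h]
    | zero => simp
    | add f g hf hg ihf ihg =>
      simp only [BoundedContinuousFunction.coe_add, Pi.add_apply]
      rw [integral_add (f.integrable _) (g.integrable _),
        integral_add (f.integrable _) (g.integrable _), ihf, ihg]
    | smul c f hf ihf =>
      simp only [BoundedContinuousFunction.coe_smul]
      rw [integral_smul, integral_smul, ihf]

end LaplaceUniqueness

/-! ### Independent marks -/

section Marking

variable {Ω : Type*} [MeasurableSpace Ω] {P : Measure Ω} [IsProbabilityMeasure P]
  {ξ : ℤ → Ω → ℝ} {lam : ℝ≥0} {E : Type*} [MeasurableSpace E]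

/-- The points of a homogeneous Poisson process carry independent marks of law `Q`. -/
structure IsMarkedPoisson (ξ : ℤ → Ω → ℝ) (Y : ℤ → Ω → E) (lam : ℝ≥0) (Q : Measure E)
    (P : Measure Ω) : Prop where
  poisson : IsHomogeneousPoisson ξ lam P
  measurable : ∀ j, Measurable (Y j)
  map_eq : ∀ j, P.map (Y j) = Q
  indep : iIndepFun Y P
  indep_init : IndepFun (fun ω j => ξ j ω) (fun ω j => Y j ω) P

variable {Y : ℤ → Ω → E} {Q : Measure E}

/-- Independence factorises finite partial sums; the limit is taken by dominated convergence with
bound `1`. -/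
lemma lintegral_expNeg_tsum_of_iIndepFun (hY : ∀ j, Measurable (Y j)) (hind : iIndepFun Y P)
    {f : ℤ → E → ℝ≥0∞} (hf : ∀ j, Measurable (f j)) {g : ℤ → ℝ≥0∞}
    (hg : ∀ j, ∫⁻ ω, expNeg (f j (Y j ω)) ∂P = expNeg (g j)) :
    ∫⁻ ω, expNeg (∑' j, f j (Y j ω)) ∂P = expNeg (∑' j, g j) := by
  have hL : Tendsto (fun s : Finset ℤ => ∫⁻ ω, expNeg (∑ j ∈ s, f j (Y j ω)) ∂P) atTop
      (𝓝 (∫⁻ ω, expNeg (∑' j, f j (Y j ω)) ∂P)) := by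
    refine tendsto_lintegral_filter_of_dominated_convergence (fun _ => 1)
      (Eventually.of_forall fun s => measurable_expNeg.comp
        (Finset.measurable_fun_sum s fun j _ => (hf j).comp (hY j)))
      (Eventually.of_forall fun s => ae_of_all _ fun ω => expNeg_le_one _) (by simp)
      (ae_of_all _ fun ω => ?_)
    exact (continuous_expNeg.tendsto _).comp ENNReal.summable.hasSum
  have hR : Tendsto (fun s : Finset ℤ => expNeg (∑ j ∈ s, g j)) atTop
      (𝓝 (expNeg (∑' j, g j))) :=
    (continuous_expNeg.tendsto _).comp ENNReal.summable.hasSum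
  refine tendsto_nhds_unique hL (hR.congr fun s => ?_)
  have hm : ∀ j, Measurable fun y => expNeg (f j y) := fun j => measurable_expNeg.comp (hf j)
  have := lintegral_prod_eq_prod_lintegral_of_indepFun s _ (hind.comp _ hm)
    (fun j => (hm j).comp (hY j))
  simp only [Function.comp_apply] at this
  simp_rw [expNeg_sum, this, hg]

/-- The Laplace functional of a marked Poisson process. -/
theorem IsMarkedPoisson.lintegral_expNeg (h : IsMarkedPoisson ξ Y lam Q P)
    {F : ℝ × E → ℝ≥0∞} (hF : Measurable F) :
    ∫⁻ ω, expNeg (∑' j, F (ξ j ω, Y j ω)) ∂P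
      = expNeg (∫⁻ p, (1 - expNeg (F p)) ∂((lam • volume : Measure ℝ).prod Q)) := by
  have hξm : Measurable fun ω j => ξ j ω := measurable_pi_lambda _ h.poisson.measurable
  have hYm : Measurable fun ω j => Y j ω := measurable_pi_lambda _ h.measurable
  have hQ : IsProbabilityMeasure Q := by
    rw [← h.map_eq 0]
    exact Measure.isProbabilityMeasure_map (h.measurable 0).aemeasurable
  let g : ℝ → ℝ≥0∞ := fun x => ∫⁻ y, expNeg (F (x, y)) ∂Q
  have hgm : Measurable g := (measurable_expNeg.comp hF).lintegral_prod_right'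
  have hg1 : ∀ x, g x ≤ 1 := fun x => by
    calc g x ≤ ∫⁻ _, 1 ∂Q := lintegral_mono fun y => expNeg_le_one _
      _ = 1 := by simp
  -- Averaging over the mark at `x` gives the weight `g x = e^{-f x}`, so conditioning on the
  -- positions reduces the claim to the unmarked process with test function `f`.
  let f : ℝ → ℝ≥0∞ := fun x => (-ENNReal.log (g x)).toENNReal
  have hfm : Measurable f := by
    have : Measurable fun x => -ENNReal.log (g x) := (ENNReal.measurable_log.comp hgm).neg
    exact this.ereal_toENNReal
  have hfg : ∀ x, expNeg (f x) = g x := fun x => exists_expNeg_eq (hg1 x)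
  have hGm : Measurable fun p : (ℤ → ℝ) × (ℤ → E) => expNeg (∑' j, F (p.1 j, p.2 j)) := by
    refine measurable_expNeg.comp (Measurable.tsum fun j => hF.comp ?_)
    fun_prop
  have hstep : ∫⁻ ω, expNeg (∑' j, F (ξ j ω, Y j ω)) ∂P = ∫⁻ ω, expNeg (∑' j, f (ξ j ω)) ∂P := by
    have h1 := (indepFun_iff_map_prod_eq_prod_map_map hξm.aemeasurable hYm.aemeasurable).1
      h.indep_init
    have h2 : ∫⁻ ω, expNeg (∑' j, F (ξ j ω, Y j ω)) ∂P
        = ∫⁻ p, expNeg (∑' j, F (p.1 j, p.2 j))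
          ∂(P.map fun ω => ((fun j => ξ j ω), (fun j => Y j ω))) :=
      (lintegral_map hGm (hξm.prodMk hYm)).symm
    have : IsProbabilityMeasure (P.map fun ω j => Y j ω) :=
      Measure.isProbabilityMeasure_map hYm.aemeasurable
    rw [h2, h1, lintegral_prod _ hGm.aemeasurable, lintegral_map hGm.lintegral_prod_right' hξm]
    refine lintegral_congr fun ω => ?_
    rw [lintegral_map (f := fun y : ℤ → E => expNeg (∑' j, F (ξ j ω, y j)))
      (hGm.comp (measurable_prodMk_left (x := fun j => ξ j ω))) hYm]
    refine lintegral_expNeg_tsum_of_iIndepFun h.measurable h.indep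
      (f := fun j y => F (ξ j ω, y)) (fun j => hF.comp measurable_prodMk_left) fun j => ?_
    rw [hfg, ← lintegral_map (f := fun y => expNeg (F (ξ j ω, y)))
      (measurable_expNeg.comp (hF.comp measurable_prodMk_left)) (h.measurable j), h.map_eq]
  rw [hstep, h.poisson.lintegral_expNeg hfm, lintegral_prod (fun p => 1 - expNeg (F p)) (measurable_const.sub (measurable_expNeg.comp hF)).aemeasurable,
    lintegral_smul_measure]
  · congr 2
    refine lintegral_congr fun x => ?_
    rw [hfg, lintegral_sub (g := fun y => expNeg (F (x, y))) (measurable_expNeg.comp (hF.comp measurable_prodMk_left))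
      ((hg1 x).trans_lt ENNReal.one_lt_top).ne (ae_of_all _ fun y => expNeg_le_one _)]
    simp [g]

end Marking

/-! ### Decomposition of a finite family of sets into atoms -/

section Pattern

variable {X ι : Type*} [Fintype ι]

open Classical in
/-- The set of indices `i` such that the point lies in `A i`. -/
noncomputable def pattern (A : ι → Set X) (p : X) : Finset ι := Finset.univ.filter fun i => p ∈ A i

lemma mem_pattern {A : ι → Set X} {p : X} {i : ι} : i ∈ pattern A p ↔ p ∈ A i := by
  simp [pattern]

variable [MeasurableSpace X]

lemma measurableSet_pattern {A : ι → Set X} (hA : ∀ i, MeasurableSet (A i)) (e : Finset ι) :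
    MeasurableSet (pattern A ⁻¹' {e}) := by
  classical
  have : pattern A ⁻¹' {e} = ⋂ i, if i ∈ e then A i else (A i)ᶜ := by
    ext p
    simp only [Set.mem_preimage, Set.mem_singleton_iff, Finset.ext_iff, mem_pattern, Set.mem_iInter]
    refine forall_congr' fun i => ?_
    by_cases hi : i ∈ e <;> simp [hi]
  rw [this]
  refine MeasurableSet.iInter fun i => ?_
  split_ifs
  exacts [hA i, (hA i).compl]

lemma lintegral_pattern {A : ι → Set X} (hA : ∀ i, MeasurableSet (A i)) (M : Measure X)
    (G : Finset ι → ℝ≥0∞) :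
    ∫⁻ p, G (pattern A p) ∂M = ∑ e, G e * M (pattern A ⁻¹' {e}) := by
  classical
  have h1 : ∀ p, G (pattern A p) = ∑ e, (pattern A ⁻¹' {e}).indicator (fun _ => G e) p := by
    intro p
    rw [Finset.sum_eq_single (pattern A p)]
    · simp
    · intro e _ he
      simp [Ne.symm he]
    · simp
  simp_rw [h1]
  rw [lintegral_finsetSum _ fun e _ => measurable_const.indicator (measurableSet_pattern hA e)]
  simp_rw [lintegral_indicator_const (measurableSet_pattern hA _)]

/-- The mass of the points with a given nonempty pattern. -/
noncomputable def patternMass (A : ι → Set X) (M : Measure X) (e : Finset ι) : ℝ≥0 :=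
  (M (pattern A ⁻¹' {e})).toNNReal

/-- A nonempty pattern is contained in some `A i` and so has finite mass. The empty pattern may have
infinite mass, read as `0` by `toNNReal`; no count involves it. -/
lemma coe_patternMass {A : ι → Set X} {M : Measure X} (hM : ∀ i, M (A i) < ∞) {e : Finset ι}
    {i : ι} (hi : i ∈ e) : (patternMass A M e : ℝ≥0∞) = M (pattern A ⁻¹' {e}) := by
  refine ENNReal.coe_toNNReal (ne_top_of_le_ne_top (hM i).ne (measure_mono fun p hp => ?_))
  rw [← mem_pattern, Set.mem_singleton_iff.1 hp]
  exact hi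

/-- The index `i` common to all patterns satisfying `q` rules out the empty pattern. Taking `q` to
be membership of several indices yields masses of intersections. -/
lemma sum_patternMass {A : ι → Set X} (hA : ∀ i, MeasurableSet (A i)) {M : Measure X}
    (hM : ∀ i, M (A i) < ∞) (q : Finset ι → Prop) [DecidablePred q] {i : ι} (hq : ∀ e, q e → i ∈ e) :
    ∑ e, (if q e then (patternMass A M e : ℝ) else 0) = M.real {p | q (pattern A p)} := by
  have h1 := lintegral_pattern hA M (fun e => if q e then 1 else 0)
  have h2 : MeasurableSet {p | q (pattern A p)} := by
    have : {p | q (pattern A p)} = ⋃ e ∈ Finset.univ.filter q, pattern A ⁻¹' {e} := by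
      ext p
      simp
    rw [this]
    exact Finset.measurableSet_biUnion _ fun e _ => measurableSet_pattern hA e
  have h3 : ∫⁻ p, (if q (pattern A p) then (1 : ℝ≥0∞) else 0) ∂M = M {p | q (pattern A p)} := by
    rw [← lintegral_indicator_one h2]
    refine lintegral_congr fun p => ?_
    simp [Set.indicator_apply]
  rw [h3] at h1
  rw [measureReal_def, h1, ENNReal.toReal_sum]
  · refine Finset.sum_congr rfl fun e _ => ?_
    split_ifs with he
    · rw [one_mul, ← coe_patternMass hM (hq e he)]
      rfl
    · simp
  · intro e _
    split_ifs with he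
    · rw [one_mul, ← coe_patternMass hM (hq e he)]
      simp
    · simp

end Pattern

/-! ### Joint law of the counts -/

section CountLaw

variable {Ω : Type*} [MeasurableSpace Ω] {P : Measure Ω}
  {ξ : ℤ → Ω → ℝ} {lam : ℝ≥0} {E : Type*} [MeasurableSpace E] {Y : ℤ → Ω → E} {Q : Measure E}
  {ι : Type*} [Fintype ι]

/-- The number of marked points in `A`. -/
noncomputable def markCount (ξ : ℤ → Ω → ℝ) (Y : ℤ → Ω → E) (A : Set (ℝ × E)) (ω : Ω) : ℝ≥0∞ :=
  ∑' j, A.indicator (fun _ => 1) (ξ j ω, Y j ω)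

lemma IsMarkedPoisson.measurable_markCount (h : IsMarkedPoisson ξ Y lam Q P) {A : Set (ℝ × E)}
    (hA : MeasurableSet A) : Measurable (markCount ξ Y A) :=
  Measurable.tsum fun j => (measurable_const.indicator hA).comp
    ((h.poisson.measurable j).prodMk (h.measurable j))

variable [IsProbabilityMeasure P]

lemma IsMarkedPoisson.lintegral_expNeg_markCount (h : IsMarkedPoisson ξ Y lam Q P)
    {A : ι → Set (ℝ × E)} (hA : ∀ i, MeasurableSet (A i)) (u : ι → ℝ≥0) :
    ∫⁻ ω, expNeg (∑ i, (u i : ℝ≥0∞) * markCount ξ Y (A i) ω) ∂P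
      = expNeg (∑ e, (1 - expNeg (∑ i ∈ e, (u i : ℝ≥0∞))) *
        ((lam • volume : Measure ℝ).prod Q) (pattern A ⁻¹' {e})) := by
  classical
  rw [← lintegral_pattern hA _ (fun e => 1 - expNeg (∑ i ∈ e, (u i : ℝ≥0∞)))]
  have h1 := h.lintegral_expNeg (F := fun p => ∑ i, (u i : ℝ≥0∞) * (A i).indicator (fun _ => 1) p)
    (Finset.measurable_fun_sum _ fun i _ => (measurable_const.indicator (hA i)).const_mul _)
  have h2 : ∀ p, ∑ i, (u i : ℝ≥0∞) * (A i).indicator (fun _ => 1) p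
      = ∑ i ∈ pattern A p, (u i : ℝ≥0∞) := by
    intro p
    rw [pattern, Finset.sum_filter]
    exact Finset.sum_congr rfl fun i _ => by by_cases hi : p ∈ A i <;> simp [hi]
  simp_rw [h2] at h1
  rw [← h1]
  refine lintegral_congr fun ω => ?_
  simp_rw [← h2, markCount, ← ENNReal.tsum_mul_left]
  rw [Summable.tsum_finsetSum fun i _ => ENNReal.summable]

/-- For `v > 0`, `e^{-v N}` vanishes where `N = ∞`, so its explicit expectation is a lower bound for
`P(N < ∞)`; this bound tends to `1` as `v = 1/(n+1) → 0`. -/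
lemma IsMarkedPoisson.markCount_lt_top (h : IsMarkedPoisson ξ Y lam Q P) {A : Set (ℝ × E)}
    (hA : MeasurableSet A) (hM : ((lam • volume : Measure ℝ).prod Q) A < ∞) :
    ∀ᵐ ω ∂P, markCount ξ Y A ω < ∞ := by
  set M := (lam • volume : Measure ℝ).prod Q
  have hm := h.measurable_markCount hA
  have hset : MeasurableSet {ω | markCount ξ Y A ω < ∞} := hm measurableSet_Iio
  have hkey : ∀ n : ℕ, expNeg ((1 - expNeg (((n : ℝ≥0) + 1)⁻¹ : ℝ≥0)) * M A)
      ≤ P {ω | markCount ξ Y A ω < ∞} := by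
    intro n
    set v : ℝ≥0 := ((n : ℝ≥0) + 1)⁻¹
    have hv : (v : ℝ≥0∞) ≠ 0 := by simp [v]
    have h1 := h.lintegral_expNeg (F := fun p => (v : ℝ≥0∞) * A.indicator (fun _ => 1) p)
      ((measurable_const.indicator hA).const_mul _)
    have h2 : ∫⁻ p, (1 - expNeg ((v : ℝ≥0∞) * A.indicator (fun _ => 1) p)) ∂M
        = (1 - expNeg v) * M A := by
      rw [← lintegral_indicator_const hA]
      refine lintegral_congr fun p => ?_
      by_cases hp : p ∈ A <;> simp [hp]
    rw [h2] at h1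
    rw [← h1, ← lintegral_indicator_one hset]
    refine lintegral_mono fun ω => ?_
    rw [ENNReal.tsum_mul_left]
    change expNeg (v * markCount ξ Y A ω) ≤ _
    by_cases hω : markCount ξ Y A ω < ∞
    · rw [Set.indicator_of_mem (by exact hω)]
      exact expNeg_le_one _
    · rw [not_lt_top_iff.1 hω, ENNReal.mul_top hv]
      simp [expNeg]
  have hlim : Tendsto (fun n : ℕ => expNeg ((1 - expNeg (((n : ℝ≥0) + 1)⁻¹ : ℝ≥0)) * M A)) atTop
      (𝓝 1) := by
    have h0 : Tendsto (fun n : ℕ => (((n : ℝ≥0) + 1)⁻¹ : ℝ≥0)) atTop (𝓝 0) := by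
      have := tendsto_one_div_add_atTop_nhds_zero_nat (𝕜 := ℝ≥0)
      simpa using this
    have h1 : Tendsto (fun n : ℕ => expNeg (((n : ℝ≥0) + 1)⁻¹ : ℝ≥0)) atTop (𝓝 1) := by
      have := (continuous_expNeg.tendsto 0).comp (ENNReal.tendsto_coe.2 h0)
      simpa [Function.comp_def] using this
    have h2 := ENNReal.Tendsto.mul_const (b := M A)
      (ENNReal.Tendsto.sub (tendsto_const_nhds (x := (1 : ℝ≥0∞))) h1 (.inl (by simp)))
      (.inr hM.ne)
    have h3 := (continuous_expNeg.tendsto _).comp h2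
    simpa [Function.comp_def] using h3
  refine (mem_ae_iff_prob_eq_one hset).2 (le_antisymm prob_le_one (le_of_tendsto' hlim hkey))

/-- The joint law of the numbers of marked points in finitely many sets: a sum over the nonempty
patterns of independent Poisson variables. -/
theorem IsMarkedPoisson.map_markCount [DecidableEq ι] (h : IsMarkedPoisson ξ Y lam Q P)
    {A : ι → Set (ℝ × E)} (hA : ∀ i, MeasurableSet (A i))
    (hM : ∀ i, ((lam • volume : Measure ℝ).prod Q) (A i) < ∞) :
    P.map (fun ω i => (markCount ξ Y (A i) ω).toNNReal)
      = (Measure.pi fun e : Finset ι =>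
          poissonMeasure (patternMass A ((lam • volume : Measure ℝ).prod Q) e)).map
        (fun n i => ∑ e : Finset ι with i ∈ e, (n e : ℝ≥0)) := by
  classical
  set M := (lam • volume : Measure ℝ).prod Q
  have hm1 : Measurable fun ω i => (markCount ξ Y (A i) ω).toNNReal :=
    measurable_pi_lambda _ fun i => (h.measurable_markCount (hA i)).ennreal_toNNReal
  have hm2 : Measurable fun (n : Finset ι → ℕ) (i : ι) => ∑ e : Finset ι with i ∈ e, (n e : ℝ≥0) := by
    fun_prop
  have : IsProbabilityMeasure (P.map fun ω i => (markCount ξ Y (A i) ω).toNNReal) :=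
    Measure.isProbabilityMeasure_map hm1.aemeasurable
  have hk : ∀ u : ι → ℝ≥0, Measurable fun x : ι → ℝ≥0 => expNeg (∑ i, (u i : ℝ≥0∞) * x i) := by
    intro u
    exact measurable_expNeg.comp (by fun_prop)
  refine ext_of_lintegral_expNeg fun u => ?_
  rw [lintegral_map (hk u) hm1, lintegral_map (hk u) hm2]
  have hL : ∫⁻ ω, expNeg (∑ i, (u i : ℝ≥0∞) * (markCount ξ Y (A i) ω).toNNReal) ∂P
      = ∫⁻ ω, expNeg (∑ i, (u i : ℝ≥0∞) * markCount ξ Y (A i) ω) ∂P := by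
    refine lintegral_congr_ae ?_
    filter_upwards [ae_all_iff.2 fun i => h.markCount_lt_top (hA i) (hM i)] with ω hω
    simp_rw [ENNReal.coe_toNNReal (hω _).ne]
  rw [hL, h.lintegral_expNeg_markCount hA]
  -- Exchanging the sums gives pattern `e` the total weight of the indices it contains.
  have hR : ∀ n : Finset ι → ℕ, expNeg (∑ i, (u i : ℝ≥0∞) *
        ((∑ e : Finset ι with i ∈ e, (n e : ℝ≥0) : ℝ≥0) : ℝ≥0∞))
      = ∏ e, expNeg ((∑ i ∈ e, (u i : ℝ≥0∞)) * n e) := by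
    intro n
    rw [← expNeg_sum]
    congr 1
    push_cast
    simp_rw [Finset.mul_sum, Finset.sum_filter, Finset.sum_mul]
    rw [Finset.sum_comm]
    refine Finset.sum_congr rfl fun e _ => ?_
    rw [← Finset.sum_filter]
    simp
  simp_rw [hR]
  have hind := iIndepFun_pi (μ := fun e : Finset ι => poissonMeasure (patternMass A M e))
    (X := fun e (k : ℕ) => expNeg ((∑ i ∈ e, (u i : ℝ≥0∞)) * k))
    (fun e => Measurable.of_discrete.aemeasurable)
  rw [lintegral_prod_eq_prod_lintegral_of_indepFun Finset.univ _ hind (fun e => by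
    exact (Measurable.of_discrete (f := fun k : ℕ => expNeg ((∑ i ∈ e, (u i : ℝ≥0∞)) * k))).comp
      (measurable_pi_apply e))]
  rw [expNeg_sum]
  refine Finset.prod_congr rfl fun e _ => ?_
  have hev := (measurePreserving_eval
    (fun e : Finset ι => poissonMeasure (patternMass A M e)) e).lintegral_comp
    (f := fun k : ℕ => expNeg ((∑ i ∈ e, (u i : ℝ≥0∞)) * k)) Measurable.of_discrete
  simp only [Function.eval] at hev
  rw [hev, lintegral_expNeg_mul_poissonMeasure]
  rcases e.eq_empty_or_nonempty with rfl | ⟨i, hi⟩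
  · simp
  · rw [coe_patternMass hM hi, mul_comm]

end CountLaw

/-! ### Second and fourth joint cumulants -/

section Moments

variable {Ω Ω' ι : Type*} [MeasurableSpace Ω] [MeasurableSpace Ω']

/-- The variables `S i` are centred, in `L⁴`, with second and fourth joint cumulants `κ₂`, `κ₄`. -/
structure HasCumulants (S : ι → Ω → ℝ) (κ₂ : ι → ι → ℝ) (κ₄ : ι → ι → ι → ι → ℝ)
    (P : Measure Ω) : Prop where
  measurable : ∀ i, Measurable (S i)
  memLp : ∀ i, MemLp (S i) 4 P
  first : ∀ i, ∫ ω, S i ω ∂P = 0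
  second : ∀ i j, ∫ ω, S i ω * S j ω ∂P = κ₂ i j
  fourth : ∀ i j k l, ∫ ω, S i ω * S j ω * S k ω * S l ω ∂P
    = κ₄ i j k l + κ₂ i j * κ₂ k l + κ₂ i k * κ₂ j l + κ₂ i l * κ₂ j k

lemma integrable_mul_of_memLp_four {P : Measure Ω} {a b c d : Ω → ℝ}
    (ha : MemLp a 4 P) (hb : MemLp b 4 P) (hc : MemLp c 4 P) (hd : MemLp d 4 P) :
    Integrable (fun ω => a ω * b ω * c ω * d ω) P := by
  have : ENNReal.HolderTriple 4 4 2 := ⟨by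
    rw [← two_mul, show (4 : ℝ≥0∞) = 2 * 2 by norm_num, ENNReal.mul_inv (by simp) (by simp),
      ← mul_assoc, ENNReal.mul_inv_cancel (by simp) (by simp), one_mul]⟩
  have h1 : MemLp (fun ω => a ω * b ω) 2 P := hb.mul' ha
  have h2 : MemLp (fun ω => c ω * d ω) 2 P := hd.mul' hc
  have h3 := h1.integrable_mul h2
  refine h3.congr (ae_of_all _ fun ω => ?_)
  simp only [Pi.mul_apply]
  ring

lemma hasCumulants_zero (P : Measure Ω) :
    HasCumulants (fun (_ : ι) _ => 0) (fun _ _ => 0) (fun _ _ _ _ => 0) P where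
  measurable _ := measurable_const
  memLp _ := MemLp.zero'
  first _ := by simp
  second _ _ := by simp
  fourth _ _ _ _ := by simp

variable {S S' : ι → Ω → ℝ} {κ₂ κ₂' : ι → ι → ℝ} {κ₄ κ₄' : ι → ι → ι → ι → ℝ} {P : Measure Ω}

/-- Cumulants of independent vectors add up. -/
theorem HasCumulants.add [IsProbabilityMeasure P] (h : HasCumulants S κ₂ κ₄ P)
    (h' : HasCumulants S' κ₂' κ₄' P)
    (hind : IndepFun (fun ω i => S i ω) (fun ω i => S' i ω) P) :
    HasCumulants (fun i ω => S i ω + S' i ω) (fun i j => κ₂ i j + κ₂' i j)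
      (fun i j k l => κ₄ i j k l + κ₄' i j k l) P := by
  have hmul : ∀ f g : (ι → ℝ) → ℝ, Measurable f → Measurable g →
      ∫ ω, f (fun i => S i ω) * g (fun i => S' i ω) ∂P
        = (∫ ω, f (fun i => S i ω) ∂P) * ∫ ω, g (fun i => S' i ω) ∂P := by
    intro f g hf hg
    exact hind.integral_fun_comp_mul_comp (measurable_pi_lambda _ h.measurable).aemeasurable
      (measurable_pi_lambda _ h'.measurable).aemeasurable hf.aestronglyMeasurable
      hg.aestronglyMeasurable
  have hL2 : ∀ i, MemLp (S i) 2 P := fun i => (h.memLp i).mono_exponent (by norm_num)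
  have hL2' : ∀ i, MemLp (S' i) 2 P := fun i => (h'.memLp i).mono_exponent (by norm_num)
  refine ⟨fun i => (h.measurable i).add (h'.measurable i), fun i => (h.memLp i).add (h'.memLp i),
    fun i => ?_, fun i j => ?_, fun i j k l => ?_⟩
  · rw [integral_add ((hL2 i).integrable (by norm_num)) ((hL2' i).integrable (by norm_num)),
      h.first, h'.first, add_zero]
  · have e : ∀ ω, (S i ω + S' i ω) * (S j ω + S' j ω)
        = S i ω * S j ω + S i ω * S' j ω + S j ω * S' i ω + S' i ω * S' j ω := fun ω => by ring
    have i1 : ∫ ω, S i ω * S' j ω ∂P = 0 := by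
      rw [hmul (fun x => x i) (fun x => x j) (by fun_prop) (by fun_prop), h.first, zero_mul]
    have i2 : ∫ ω, S j ω * S' i ω ∂P = 0 := by
      rw [hmul (fun x => x j) (fun x => x i) (by fun_prop) (by fun_prop), h.first, zero_mul]
    have t1 : Integrable (fun ω => S i ω * S j ω) P := (hL2 i).integrable_mul (hL2 j)
    have t2 : Integrable (fun ω => S i ω * S' j ω) P := (hL2 i).integrable_mul (hL2' j)
    have t3 : Integrable (fun ω => S j ω * S' i ω) P := (hL2 j).integrable_mul (hL2' i)
    have t4 : Integrable (fun ω => S' i ω * S' j ω) P := (hL2' i).integrable_mul (hL2' j)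
    simp_rw [e]
    rw [integral_add ((t1.fun_add t2).fun_add t3) t4, integral_add (t1.fun_add t2) t3, integral_add t1 t2,
      i1, i2, h.second, h'.second]
    ring
  -- The product expands into sixteen terms, one for each choice of `S` or `S'` in each factor. The
  -- eight 3+1 terms vanish by independence and centring; the six 2+2 terms are the cross terms in
  -- the products of `κ₂ + κ₂'` over the three pairings.
  · let T : Bool → ι → Ω → ℝ := fun b => if b then S else S'
    have hT : ∀ b i, MemLp (T b i) 4 P := by
      rintro (_ | _) i
      exacts [h'.memLp i, h.memLp i]
    have e : ∀ ω, (S i ω + S' i ω) * (S j ω + S' j ω) * (S k ω + S' k ω) * (S l ω + S' l ω)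
        = ∑ b : Bool × Bool × Bool × Bool,
          T b.1 i ω * T b.2.1 j ω * T b.2.2.1 k ω * T b.2.2.2 l ω := by
      intro ω
      simp only [Fintype.sum_prod_type, Fintype.sum_bool, T, if_true, Bool.false_eq_true, if_false]
      ring
    simp_rw [e]
    rw [integral_finsetSum _ fun b _ =>
      integrable_mul_of_memLp_four (hT _ _) (hT _ _) (hT _ _) (hT _ _)]
    simp only [Fintype.sum_prod_type, Fintype.sum_bool, T, if_true, Bool.false_eq_true, if_false]
    have h31 : ∀ a b c d, ∫ ω, S a ω * S b ω * S c ω * S' d ω ∂P = 0 := by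
      intro a b c d
      rw [hmul (fun x => x a * x b * x c) (fun x => x d) (by fun_prop) (by fun_prop),
        h'.first, mul_zero]
    have h13 : ∀ a b c d, ∫ ω, S a ω * (S' b ω * S' c ω * S' d ω) ∂P = 0 := by
      intro a b c d
      rw [hmul (fun x => x a) (fun x => x b * x c * x d) (by fun_prop) (by fun_prop),
        h.first, zero_mul]
    have h22 : ∀ a b c d, ∫ ω, (S a ω * S b ω) * (S' c ω * S' d ω) ∂P = κ₂ a b * κ₂' c d := by
      intro a b c d
      rw [hmul (fun x => x a * x b) (fun x => x c * x d) (by fun_prop) (by fun_prop),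
        h.second, h'.second]
    have c1 : ∫ ω, S i ω * S j ω * S' k ω * S l ω ∂P = 0 := by
      rw [← h31 i j l k]; congr with ω; ring
    have c2 : ∫ ω, S i ω * S' j ω * S k ω * S l ω ∂P = 0 := by
      rw [← h31 i k l j]; congr with ω; ring
    have c3 : ∫ ω, S' i ω * S j ω * S k ω * S l ω ∂P = 0 := by
      rw [← h31 j k l i]; congr with ω; ring
    have d1 : ∫ ω, S i ω * S' j ω * S' k ω * S' l ω ∂P = 0 := by
      rw [← h13 i j k l]; congr with ω; ring
    have d2 : ∫ ω, S' i ω * S j ω * S' k ω * S' l ω ∂P = 0 := by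
      rw [← h13 j i k l]; congr with ω; ring
    have d3 : ∫ ω, S' i ω * S' j ω * S k ω * S' l ω ∂P = 0 := by
      rw [← h13 k i j l]; congr with ω; ring
    have d4 : ∫ ω, S' i ω * S' j ω * S' k ω * S l ω ∂P = 0 := by
      rw [← h13 l i j k]; congr with ω; ring
    have q1 : ∫ ω, S i ω * S j ω * S' k ω * S' l ω ∂P = κ₂ i j * κ₂' k l := by
      rw [← h22 i j k l]; congr with ω; ring
    have q2 : ∫ ω, S i ω * S' j ω * S k ω * S' l ω ∂P = κ₂ i k * κ₂' j l := by
      rw [← h22 i k j l]; congr with ω; ring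
    have q3 : ∫ ω, S i ω * S' j ω * S' k ω * S l ω ∂P = κ₂ i l * κ₂' j k := by
      rw [← h22 i l j k]; congr with ω; ring
    have q4 : ∫ ω, S' i ω * S j ω * S k ω * S' l ω ∂P = κ₂ j k * κ₂' i l := by
      rw [← h22 j k i l]; congr with ω; ring
    have q5 : ∫ ω, S' i ω * S j ω * S' k ω * S l ω ∂P = κ₂ j l * κ₂' i k := by
      rw [← h22 j l i k]; congr with ω; ring
    have q6 : ∫ ω, S' i ω * S' j ω * S k ω * S l ω ∂P = κ₂ k l * κ₂' i j := by
      rw [← h22 k l i j]; congr with ω; ring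
    rw [h31, c1, c2, c3, d1, d2, d3, d4, q1, q2, q3, q4, q5, q6, h.fourth, h'.fourth]
    ring

lemma HasCumulants.of_map {X : Ω → Ω'} (hX : Measurable X) {S : ι → Ω' → ℝ}
    (h : HasCumulants S κ₂ κ₄ (P.map X)) : HasCumulants (fun i ω => S i (X ω)) κ₂ κ₄ P where
  measurable i := (h.measurable i).comp hX
  memLp i := (memLp_map_measure_iff (h.measurable i).aestronglyMeasurable hX.aemeasurable).1 (h.memLp i)
  first i := by
    rw [← integral_map hX.aemeasurable (h.measurable i).aestronglyMeasurable, h.first]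
  second i j := by
    rw [← integral_map (f := fun x => S i x * S j x) hX.aemeasurable
      ((h.measurable i).mul (h.measurable j)).aestronglyMeasurable, h.second]
  fourth i j k l := by
    rw [← integral_map (f := fun x => S i x * S j x * S k x * S l x) hX.aemeasurable
      ((((h.measurable i).mul (h.measurable j)).mul (h.measurable k)).mul
        (h.measurable l)).aestronglyMeasurable, h.fourth]

lemma HasCumulants.to_map {X : Ω → Ω'} (hX : Measurable X) {S : ι → Ω' → ℝ}
    (hS : ∀ i, Measurable (S i)) (h : HasCumulants (fun i ω => S i (X ω)) κ₂ κ₄ P) :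
    HasCumulants S κ₂ κ₄ (P.map X) where
  measurable := hS
  memLp i := (memLp_map_measure_iff (hS i).aestronglyMeasurable hX.aemeasurable).2 (h.memLp i)
  first i := by
    rw [integral_map hX.aemeasurable (hS i).aestronglyMeasurable, h.first]
  second i j := by
    rw [integral_map (f := fun x => S i x * S j x) hX.aemeasurable
      ((hS i).mul (hS j)).aestronglyMeasurable, h.second]
  fourth i j k l := by
    rw [integral_map (f := fun x => S i x * S j x * S k x * S l x) hX.aemeasurable
      ((((hS i).mul (hS j)).mul (hS k)).mul (hS l)).aestronglyMeasurable, h.fourth]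

/-- Each summand is a fixed vector times a scalar variable, so independence of the scalars makes the
vectors independent. -/
lemma HasCumulants.sum [IsProbabilityMeasure P] {β : Type*} {Z : β → Ω → ℝ}
    {a : β → ι → ℝ} {k₂ : β → ι → ι → ℝ} {k₄ : β → ι → ι → ι → ι → ℝ} (hind : iIndepFun Z P)
    (hZ : ∀ b, Measurable (Z b))
    (h : ∀ b, HasCumulants (fun i ω => a b i * Z b ω) (k₂ b) (k₄ b) P) (s : Finset β) :
    HasCumulants (fun i ω => ∑ b ∈ s, a b i * Z b ω) (fun i j => ∑ b ∈ s, k₂ b i j)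
      (fun i j k l => ∑ b ∈ s, k₄ b i j k l) P := by
  classical
  induction s using Finset.induction_on with
  | empty => simpa using hasCumulants_zero P
  | insert b s hb ih =>
    simp_rw [Finset.sum_insert hb]
    refine (h b).add ih ?_
    have h1 := hind.indepFun_finset {b} s (by simpa using hb) hZ
    have hb' : b ∈ ({b} : Finset β) := Finset.mem_singleton_self b
    have m1 : Measurable fun (x : ({b} : Finset β) → ℝ) (i : ι) => a b i * x ⟨b, hb'⟩ :=
      measurable_pi_lambda _ fun i => (measurable_pi_apply _).const_mul _
    have m2 : Measurable fun (x : s → ℝ) (i : ι) => ∑ c ∈ s.attach, a c i * x c :=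
      measurable_pi_lambda _ fun i => Finset.measurable_fun_sum _ fun c _ =>
        (measurable_pi_apply _).const_mul _
    exact (h1.comp m1 m2).congr
      (ae_of_all _ fun ω => rfl) (ae_of_all _ fun ω => by
        ext i
        exact Finset.sum_attach s fun c => a c i * Z c ω)

end Moments

/-! ### Moments of the Poisson distribution -/

section PoissonMoments

/-- The first `k` terms vanish, and shifting the index by `k` leaves `m ^ k` times the total mass of
the distribution. -/
lemma hasSum_descFactorial_poisson (m : ℝ≥0) (k : ℕ) :
    HasSum (fun n : ℕ => Real.exp (-m) * m ^ n / n.factorial * (n.descFactorial k : ℝ)) (m ^ k) := by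
  have h0 : ∀ n ∈ Finset.range k,
      Real.exp (-m) * m ^ n / n.factorial * (n.descFactorial k : ℝ) = 0 := by
    intro n hn
    rw [Nat.descFactorial_eq_zero_iff_lt.2 (Finset.mem_range.1 hn)]
    simp
  rw [← hasSum_nat_add_iff' k, Finset.sum_eq_zero h0, sub_zero]
  have h1 := ((hasSum_one_poissonMeasure m).mul_left ((m : ℝ) ^ k))
  rw [mul_one] at h1
  refine (congrArg (fun f => HasSum f ((m : ℝ) ^ k)) (funext fun n => ?_)).mpr h1
  have h2 : (((n + k).factorial : ℕ) : ℝ) = n.factorial * ((n + k).descFactorial k : ℝ) := by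
    rw [← Nat.factorial_mul_descFactorial (Nat.le_add_left k n), Nat.add_sub_cancel]
    push_cast; rfl
  have h3 : ((n + k).descFactorial k : ℝ) ≠ 0 := by
    have : (n + k).descFactorial k ≠ 0 := fun h =>
      absurd (Nat.descFactorial_eq_zero_iff_lt.1 h) (by omega)
    exact_mod_cast this
  rw [h2, pow_add]
  field_simp

lemma integrable_descFactorial_poisson (m : ℝ≥0) (k : ℕ) :
    Integrable (fun n : ℕ => (n.descFactorial k : ℝ)) (poissonMeasure m) := by
  rw [integrable_poissonMeasure_iff]
  simpa using (hasSum_descFactorial_poisson m k).summable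

lemma integral_descFactorial_poisson (m : ℝ≥0) (k : ℕ) :
    ∫ n : ℕ, (n.descFactorial k : ℝ) ∂(poissonMeasure m) = (m : ℝ) ^ k := by
  rw [integral_poissonMeasure]
  exact (hasSum_descFactorial_poisson m k).tsum_eq

/-- Falling factorials have the simple means `m ^ k`. Small `n` are separate cases because
`descFactorial` uses truncated subtraction. -/
lemma pow_four_eq_descFactorial (n : ℕ) (m : ℝ) : ((n : ℝ) - m) ^ 4
    = n.descFactorial 4 + (6 - 4 * m) * n.descFactorial 3
      + (7 - 12 * m + 6 * m ^ 2) * n.descFactorial 2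
      + (1 - 4 * m + 6 * m ^ 2 - 4 * m ^ 3) * n.descFactorial 1 + m ^ 4 * n.descFactorial 0 := by
  rcases n with _ | _ | _ | _ | n <;> simp [Nat.descFactorial] <;> ring

lemma pow_two_eq_descFactorial (n : ℕ) (m : ℝ) : ((n : ℝ) - m) ^ 2
    = n.descFactorial 2 + (1 - 2 * m) * n.descFactorial 1 + m ^ 2 * n.descFactorial 0 := by
  rcases n with _ | _ | n <;> simp [Nat.descFactorial] <;> ring

/-- Second and fourth central moments of the Poisson distribution, for a scaled variable. -/
lemma hasCumulants_poisson {ι : Type*} (m : ℝ≥0) (a : ι → ℝ) :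
    HasCumulants (fun i (n : ℕ) => a i * ((n : ℝ) - m)) (fun i j => a i * a j * m)
      (fun i j k l => a i * a j * a k * a l * m) (poissonMeasure m) := by
  have hI := integrable_descFactorial_poisson m
  have h4I : Integrable (fun n : ℕ => ((n : ℝ) - m) ^ 4) (poissonMeasure m) := by
    simp_rw [pow_four_eq_descFactorial]
    exact ((((hI 4).fun_add ((hI 3).const_mul _)).fun_add ((hI 2).const_mul _)).fun_add
      ((hI 1).const_mul _)).fun_add ((hI 0).const_mul _)
  have h1 : ∫ n : ℕ, ((n : ℝ) - m) ∂(poissonMeasure m) = 0 := by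
    have e : ∀ n : ℕ, (n : ℝ) - m = n.descFactorial 1 - m * n.descFactorial 0 := by simp
    simp_rw [e]
    rw [integral_sub (hI 1) ((hI 0).const_mul _), integral_const_mul]
    simp_rw [integral_descFactorial_poisson]
    ring
  have h2 : ∫ n : ℕ, ((n : ℝ) - m) ^ 2 ∂(poissonMeasure m) = m := by
    simp_rw [pow_two_eq_descFactorial]
    rw [integral_add ((hI 2).fun_add ((hI 1).const_mul _)) ((hI 0).const_mul _),
      integral_add (hI 2) ((hI 1).const_mul _), integral_const_mul, integral_const_mul]
    simp_rw [integral_descFactorial_poisson]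
    ring
  -- The three pairings of the variance `m` account for `3 m²`, leaving the fourth cumulant `m`.
  have h4 : ∫ n : ℕ, ((n : ℝ) - m) ^ 4 ∂(poissonMeasure m) = m + 3 * m ^ 2 := by
    simp_rw [pow_four_eq_descFactorial]
    rw [integral_add ((((hI 4).fun_add ((hI 3).const_mul _)).fun_add ((hI 2).const_mul _)).fun_add
        ((hI 1).const_mul _)) ((hI 0).const_mul _),
      integral_add (((hI 4).fun_add ((hI 3).const_mul _)).fun_add ((hI 2).const_mul _))
        ((hI 1).const_mul _),
      integral_add ((hI 4).fun_add ((hI 3).const_mul _)) ((hI 2).const_mul _),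
      integral_add (hI 4) ((hI 3).const_mul _), integral_const_mul, integral_const_mul,
      integral_const_mul, integral_const_mul]
    simp_rw [integral_descFactorial_poisson]
    ring
  refine ⟨fun i => .of_discrete, fun i => MemLp.const_mul ?_ _, fun i => ?_, fun i j => ?_,
    fun i j k l => ?_⟩
  · have := integrable_norm_rpow_iff (μ := poissonMeasure m) (p := 4)
      (f := fun n : ℕ => (n : ℝ) - m) Measurable.of_discrete.aestronglyMeasurable
      (by norm_num) (by norm_num)
    refine this.1 (h4I.congr (ae_of_all _ fun n => ?_))
    beta_reduce
    rw [show (4 : ℝ≥0∞).toReal = ((4 : ℕ) : ℝ) by norm_num, Real.rpow_natCast, Real.norm_eq_abs,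
      Even.pow_abs (by decide : Even 4)]
  · rw [integral_const_mul, h1, mul_zero]
  · have e : ∀ n : ℕ, a i * ((n : ℝ) - m) * (a j * ((n : ℝ) - m))
        = (a i * a j) * ((n : ℝ) - m) ^ 2 := fun n => by ring
    simp_rw [e]
    rw [integral_const_mul, h2]
  · have e : ∀ n : ℕ, a i * ((n : ℝ) - m) * (a j * ((n : ℝ) - m)) * (a k * ((n : ℝ) - m))
        * (a l * ((n : ℝ) - m)) = (a i * a j * a k * a l) * ((n : ℝ) - m) ^ 4 := fun n => by ring
    simp_rw [e]
    rw [integral_const_mul, h4]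
    ring

end PoissonMoments

/-! ### Cumulants of the Smoluchowski process -/

section

variable {Ω : Type*} [MeasurableSpace Ω] {P : Measure Ω}
  {ξ : ℤ → Ω → ℝ} {lam : ℝ≥0}

variable [IsProbabilityMeasure P] in
/-- Cumulants of the numbers of marked points in finitely many sets. -/
theorem IsMarkedPoisson.hasCumulants {E ι : Type*} [MeasurableSpace E] {Y : ℤ → Ω → E}
    {Q : Measure E} [Fintype ι] (h : IsMarkedPoisson ξ Y lam Q P) {M : Measure (ℝ × E)}
    (hMdef : M = (lam • volume : Measure ℝ).prod Q)
    {A : ι → Set (ℝ × E)} (hA : ∀ i, MeasurableSet (A i)) (hM : ∀ i, M (A i) < ∞) :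
    HasCumulants (fun i ω => (markCount ξ Y (A i) ω).toReal - M.real (A i))
      (fun i j => M.real (A i ∩ A j)) (fun i j k l => M.real (A i ∩ A j ∩ A k ∩ A l)) P := by
  classical
  have hNm : Measurable fun ω i => (markCount ξ Y (A i) ω).toNNReal :=
    measurable_pi_lambda _ fun i => (h.measurable_markCount (hA i)).ennreal_toNNReal
  set μ := Measure.pi fun e : Finset ι => poissonMeasure (patternMass A M e) with hμ
  -- The `i`-th centred count is the sum of the independent centred Poisson variables `Z e` with
  -- incidence coefficients `a e i`. Products of these coefficients select the patterns lying in an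
  -- intersection.
  let a : Finset ι → ι → ℝ := fun e i => if i ∈ e then 1 else 0
  let Z : Finset ι → (Finset ι → ℕ) → ℝ := fun e n => (n e : ℝ) - patternMass A M e
  have hZm : ∀ e, Measurable (Z e) := fun e => by fun_prop
  have hZi : iIndepFun Z μ := iIndepFun_pi
    (X := fun e (k : ℕ) => (k : ℝ) - patternMass A M e) fun e => Measurable.of_discrete.aemeasurable
  have hZ : ∀ e, HasCumulants (fun i n => a e i * Z e n)
      (fun i j => a e i * a e j * patternMass A M e)
      (fun i j k l => a e i * a e j * a e k * a e l * patternMass A M e) μ := by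
    intro e
    have h1 := hasCumulants_poisson (patternMass A M e) (a e)
    rw [← (measurePreserving_eval (fun e : Finset ι => poissonMeasure (patternMass A M e)) e).map_eq]
      at h1
    exact HasCumulants.of_map (P := μ) (X := Function.eval e)
      (S := fun i (k : ℕ) => a e i * ((k : ℝ) - patternMass A M e)) (measurable_pi_apply e) h1
  have hsum := HasCumulants.sum hZi hZm hZ Finset.univ
  have hV : Measurable fun (n : Finset ι → ℕ) (i : ι) => ∑ e : Finset ι with i ∈ e, (n e : ℝ≥0) := by
    fun_prop
  have e1 : ∀ i, ∑ e : Finset ι with i ∈ e, (patternMass A M e : ℝ) = M.real (A i) := by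
    intro i
    rw [Finset.sum_filter, sum_patternMass hA hM (fun e => i ∈ e) (fun e he => he)]
    simp_rw [mem_pattern, Set.ofPred_mem_eq]
  have e2 : ∀ i j, ∑ e, a e i * a e j * patternMass A M e = M.real (A i ∩ A j) := by
    intro i j
    have := sum_patternMass hA hM (fun e => i ∈ e ∧ j ∈ e) (fun e he => he.1)
    simp_rw [mem_pattern] at this
    rw [show A i ∩ A j = {p | p ∈ A i ∧ p ∈ A j} from rfl, ← this]
    refine Finset.sum_congr rfl fun e _ => ?_
    by_cases hi : i ∈ e <;> by_cases hj : j ∈ e <;> simp [a, hi, hj]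
  have e4 : ∀ i j k l, ∑ e, a e i * a e j * a e k * a e l * patternMass A M e
      = M.real (A i ∩ A j ∩ A k ∩ A l) := by
    intro i j k l
    have := sum_patternMass hA hM (fun e => ((i ∈ e ∧ j ∈ e) ∧ k ∈ e) ∧ l ∈ e)
      (fun e he => he.1.1.1)
    simp_rw [mem_pattern] at this
    rw [show A i ∩ A j ∩ A k ∩ A l = {p | ((p ∈ A i ∧ p ∈ A j) ∧ p ∈ A k) ∧ p ∈ A l} from rfl,
      ← this]
    refine Finset.sum_congr rfl fun e _ => ?_
    by_cases hi : i ∈ e <;> by_cases hj : j ∈ e <;> by_cases hk : k ∈ e <;> by_cases hl : l ∈ e <;>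
      simp [a, hi, hj, hk, hl]
  have e5 : ∀ i (n : Finset ι → ℕ), ∑ e, a e i * Z e n
      = ((∑ e : Finset ι with i ∈ e, (n e : ℝ≥0) : ℝ≥0) : ℝ) - M.real (A i) := by
    intro i n
    rw [← e1, NNReal.coe_sum, ← Finset.sum_sub_distrib, Finset.sum_filter]
    refine Finset.sum_congr rfl fun e _ => ?_
    by_cases hi : i ∈ e <;> simp [a, Z, hi]
  simp_rw [e2, e4, e5] at hsum
  have h2 := HasCumulants.to_map (S := fun i (x : ι → ℝ≥0) => (x i : ℝ) - M.real (A i)) hV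
    (fun i => by fun_prop) hsum
  rw [hμ, hMdef, ← h.map_markCount hA (by rwa [← hMdef]), ← hMdef] at h2
  exact h2.of_map hNm

/-- The mean length of the overlap of `[-r, r]` with its translate by a centred Gaussian variable
of variance `σ² v`. -/
noncomputable def overlap (r σ : ℝ) (v : ℝ≥0) : ℝ :=
  ∫ y, max (2 * r - σ * |y|) 0 ∂(gaussianReal 0 v)

variable {W : ℤ → ℝ≥0 → Ω → ℝ} {r σ : ℝ}

lemma IsBrownianParticleSystem.isMarkedPoisson {ι : Type*} [Fintype ι]
    (h : IsBrownianParticleSystem ξ W lam P) (t : ι → ℝ≥0) :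
    IsMarkedPoisson ξ (fun j ω i => W j (t i) ω) lam (P.map fun ω i => W 0 (t i) ω) P where
  poisson := h.poisson
  measurable j := measurable_pi_lambda _ fun i => h.measurable j _
  map_eq j := by
    classical
    -- The times may repeat, so the common law is read off from the Brownian law on the set of
    -- distinct times.
    let I : Finset ℝ≥0 := Finset.univ.image t
    have hI : ∀ i, t i ∈ I := fun i => Finset.mem_image_of_mem _ (Finset.mem_univ i)
    have hφ : Measurable fun (x : I → ℝ) (i : ι) => x ⟨t i, hI i⟩ := by fun_prop
    have key : ∀ j, P.map (fun ω i => W j (t i) ω)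
        = (BrownianReal.projectiveFamily I).map fun (x : I → ℝ) (i : ι) => x ⟨t i, hI i⟩ := by
      intro j
      have h1 := (h.brownian j).hasLaw I
      rw [← h1.map_eq, AEMeasurable.map_map_of_aemeasurable hφ.aemeasurable h1.aemeasurable]
      rfl
    rw [key j, key 0]
  indep := h.indep.comp (fun _ w i => w (t i)) fun _ => by fun_prop
  indep_init := h.indep_init.comp (φ := id) (ψ := fun (w : ℤ → ℝ≥0 → ℝ) j i => w j (t i))
    measurable_id (by fun_prop)

variable [IsProbabilityMeasure P]

/-- The trajectories lying in `[-r, r]` at the `i`-th time. -/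
def hitSet {ι : Type*} (r σ : ℝ) (i : ι) : Set (ℝ × (ι → ℝ)) :=
  {p | p.1 + σ * p.2 i ∈ Metric.closedBall (0 : ℝ) r}

lemma measurableSet_hitSet {ι : Type*} (i : ι) : MeasurableSet (hitSet r σ i) := by
  have : Measurable fun p : ℝ × (ι → ℝ) => p.1 + σ * p.2 i := by fun_prop
  exact this measurableSet_closedBall

lemma integrable_overlap (hσ : 0 < σ) (μ : Measure ℝ) [IsProbabilityMeasure μ] :
    Integrable (fun y => max (2 * r - σ * |y|) 0) μ := by
  refine Integrable.of_bound (C := |2 * r|) (by fun_prop) (ae_of_all _ fun y => ?_)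
  rw [Real.norm_eq_abs, abs_of_nonneg (le_max_right _ _)]
  refine max_le ?_ (abs_nonneg _)
  have := le_abs_self (2 * r)
  have : 0 ≤ σ * |y| := by positivity
  linarith

/-- For fixed marks the admissible starting points form the intersection of two translates of `[-r,
r]`, of length the positive part of `2r - σ|y i - y j|`. The difference of the marks is a Brownian
increment, of variance `|t i - t j|`. -/
lemma IsBrownianParticleSystem.measure_hitSet_inter {ι : Type*} [Fintype ι]
    (h : IsBrownianParticleSystem ξ W lam P) (hσ : 0 < σ) (t : ι → ℝ≥0) (i j : ι) :
    ((lam • volume : Measure ℝ).prod (P.map fun ω i => W 0 (t i) ω)) (hitSet r σ i ∩ hitSet r σ j)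
      = ENNReal.ofReal (lam * overlap r σ (nndist (t i) (t j))) := by
  have hm : Measurable fun ω i => W 0 (t i) ω := measurable_pi_lambda _ fun i => h.measurable 0 _
  have hQ : IsProbabilityMeasure (P.map fun ω i => W 0 (t i) ω) :=
    Measure.isProbabilityMeasure_map hm.aemeasurable
  have hslice : ∀ y : ι → ℝ, (fun x => (x, y)) ⁻¹' (hitSet r σ i ∩ hitSet r σ j)
      = Set.Icc (max (-r - σ * y i) (-r - σ * y j)) (min (r - σ * y i) (r - σ * y j)) := by
    intro y
    ext x
    simp only [hitSet, Set.mem_preimage, Set.mem_inter_iff, Set.mem_ofPred_eq,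
      mem_closedBall_zero_iff, Real.norm_eq_abs, abs_le, Set.mem_Icc, max_le_iff, le_min_iff]
    constructor
    · rintro ⟨⟨h1, h2⟩, h3, h4⟩
      exact ⟨⟨by linarith, by linarith⟩, by linarith, by linarith⟩
    · rintro ⟨⟨h1, h2⟩, h3, h4⟩
      exact ⟨⟨by linarith, by linarith⟩, by linarith, by linarith⟩
  have hlen : ∀ y : ι → ℝ, min (r - σ * y i) (r - σ * y j) - max (-r - σ * y i) (-r - σ * y j)
      = 2 * r - σ * |y i - y j| := by
    intro y
    rcases le_total (y i) (y j) with hy | hy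
    · have : σ * y i ≤ σ * y j := by gcongr
      rw [abs_of_nonpos (by linarith), min_eq_right (by linarith), max_eq_left (by linarith)]
      ring
    · have : σ * y j ≤ σ * y i := by gcongr
      rw [abs_of_nonneg (by linarith), min_eq_left (by linarith), max_eq_right (by linarith)]
      ring
  have hgm : Measurable fun z : ℝ => ENNReal.ofReal (2 * r - σ * |z|) := by fun_prop
  have hlaw := (h.brownian 0).hasLaw_sub (t i) (t j)
  rw [Measure.prod_apply_symm ((measurableSet_hitSet i).inter (measurableSet_hitSet j))]
  simp_rw [hslice, Measure.smul_apply, Real.volume_Icc, hlen]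
  rw [lintegral_map (by fun_prop) hm]
  have e1 : ∫⁻ ω, lam • ENNReal.ofReal (2 * r - σ * |W 0 (t i) ω - W 0 (t j) ω|) ∂P
      = lam * ∫⁻ z, ENNReal.ofReal (2 * r - σ * |z|) ∂(gaussianReal 0 (nndist (t i) (t j))) := by
    have e3 := hlaw.lintegral_comp hgm.aemeasurable
    simp only [Pi.sub_apply] at e3
    change _ = _ * ∫⁻ z, _ ∂(gaussianReal 0 (nndist (t i).1 (t j).1))
    rw [← e3, ← lintegral_const_mul _ (by
      exact hgm.comp ((h.measurable 0 (t i)).sub (h.measurable 0 (t j))))]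
    rfl
  rw [e1, ENNReal.ofReal_mul (by positivity), ENNReal.ofReal_coe_nnreal, overlap,
    ofReal_integral_eq_lintegral_ofReal (integrable_overlap hσ _)
      (ae_of_all _ fun y => le_max_right _ _)]
  congr 2 with z
  rcases le_total 0 (2 * r - σ * |z|) with hz | hz
  · rw [max_eq_left hz]
  · rw [max_eq_right hz, ENNReal.ofReal_of_nonpos hz, ENNReal.ofReal_zero]

lemma overlap_nonneg (r σ : ℝ) (v : ℝ≥0) : 0 ≤ overlap r σ v :=
  integral_nonneg fun _ => le_max_right _ _

lemma overlap_zero (hr : 0 < r) : overlap r σ 0 = 2 * r := by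
  simp [overlap, gaussianReal_zero_var, hr.le]

lemma meanCount_eq (lam : ℝ≥0) (hr : 0 < r) : meanCount lam r = lam * (2 * r) := by
  rw [meanCount, measureReal_def, Real.volume_closedBall, ENNReal.toReal_ofReal (by positivity)]

/-- Cumulants of the centred Smoluchowski process at finitely many times. -/
theorem IsBrownianParticleSystem.hasCumulants_count {ι : Type*} [Fintype ι]
    (h : IsBrownianParticleSystem ξ W lam P) (hr : 0 < r) (hσ : 0 < σ) (t : ι → ℝ≥0) :
    ∃ κ₄ : ι → ι → ι → ι → ℝ,
      HasCumulants (fun i ω => count ξ W r σ ω (t i) - meanCount lam r)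
        (fun i j => lam * overlap r σ (nndist (t i) (t j))) κ₄ P ∧
      ∀ i j k l, κ₄ i j k l ≤ lam * overlap r σ (nndist (t i) (t k)) := by
  set M := (lam • volume : Measure ℝ).prod (P.map fun ω i => W 0 (t i) ω) with hM
  have hreal : ∀ i j, M.real (hitSet r σ i ∩ hitSet r σ j)
      = lam * overlap r σ (nndist (t i) (t j)) := by
    intro i j
    rw [measureReal_def, h.measure_hitSet_inter hσ, ENNReal.toReal_ofReal]
    exact mul_nonneg lam.2 (overlap_nonneg _ _ _)
  have hfin : ∀ i j, M (hitSet r σ i ∩ hitSet r σ j) < ∞ := fun i j => by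
    rw [h.measure_hitSet_inter hσ]
    exact ENNReal.ofReal_lt_top
  have hmean : ∀ i, M.real (hitSet r σ i) = meanCount lam r := by
    intro i
    have := hreal i i
    rwa [Set.inter_self, nndist_self, overlap_zero hr, ← meanCount_eq lam hr] at this
  have hc := (h.isMarkedPoisson t).hasCumulants hM (A := hitSet r σ) measurableSet_hitSet
    (fun i => by simpa using hfin i i)
  simp_rw [hmean, hreal] at hc
  refine ⟨_, hc, fun i j k l => ?_⟩
  rw [← hreal]
  -- The fourth cumulant is the mass of a fourfold intersection. Keeping only the sets `i` and `k`
  -- pairs the first factors of the two products in the variance.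
  exact measureReal_mono (fun p hp => ⟨hp.1.1.1, hp.1.2⟩) (hfin i k).ne

end

/-! ### Short- and long-time behaviour of the overlap -/

section Overlap

variable {r σ : ℝ} {v : ℝ≥0}

lemma integral_Ioi_mul_exp_neg_sq {v : ℝ} (hv : 0 < v) (a : ℝ) (ha : 0 ≤ a) :
    ∫ x in Set.Ioi a, x * Real.exp (-x ^ 2 / (2 * v)) = v * Real.exp (-a ^ 2 / (2 * v)) := by
  have hlim : Tendsto (fun x : ℝ => -v * Real.exp (-x ^ 2 / (2 * v))) atTop (𝓝 0) := by
    have h1 : Tendsto (fun x : ℝ => -x ^ 2 / (2 * v)) atTop atBot := by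
      refine Tendsto.atBot_div_const (by positivity) ?_
      exact tendsto_neg_atTop_atBot.comp (tendsto_pow_atTop two_ne_zero)
    simpa using (Real.tendsto_exp_atBot.comp h1).const_mul (-v)
  rw [integral_Ioi_of_hasDerivAt_of_nonneg' (g := fun x : ℝ => -v * Real.exp (-x ^ 2 / (2 * v)))
    (fun x _ => ?_) (fun x hx => ?_) hlim]
  · ring
  · have h1 : HasDerivAt (fun x : ℝ => -x ^ 2 / (2 * v)) (-(2 * x) / (2 * v)) x := by
      simpa using ((hasDerivAt_pow 2 x).neg).div_const (2 * v)
    refine (h1.exp.const_mul (-v)).congr_deriv ?_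
    field_simp
  · have : 0 ≤ x := ha.trans (le_of_lt hx)
    positivity

lemma integral_abs_tail_gaussianReal (hv : v ≠ 0) {a : ℝ} (ha : 0 ≤ a) :
    ∫ y, (Set.Ioi a).indicator id |y| ∂(gaussianReal 0 v)
      = √(2 * v / Real.pi) * Real.exp (-a ^ 2 / (2 * v)) := by
  have hv' : (0 : ℝ) < v := by positivity
  rw [integral_gaussianReal_eq_integral_smul hv]
  have e1 : ∀ y : ℝ, gaussianPDFReal 0 v y • (Set.Ioi a).indicator id |y|
      = (fun z : ℝ => (√(2 * Real.pi * v))⁻¹ *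
        (Set.Ioi a).indicator (fun z => z * Real.exp (-z ^ 2 / (2 * v))) z) |y| := by
    intro y
    by_cases hy : |y| ∈ Set.Ioi a
    · simp only [Set.indicator_of_mem hy, gaussianPDFReal, smul_eq_mul, id, sub_zero, sq_abs]
      ring
    · simp [Set.indicator_of_notMem hy]
  simp_rw [e1]
  rw [integral_comp_abs (f := fun z : ℝ => (√(2 * Real.pi * v))⁻¹ *
        (Set.Ioi a).indicator (fun z => z * Real.exp (-z ^ 2 / (2 * v))) z),
    integral_const_mul, setIntegral_indicator measurableSet_Ioi, Set.Ioi_inter_Ioi,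
    sup_eq_right.2 ha, integral_Ioi_mul_exp_neg_sq hv' a ha]
  have e2 : √(2 * v / Real.pi) * √(2 * Real.pi * v) = 2 * v := by
    rw [← Real.sqrt_mul (by positivity), show 2 * (v : ℝ) / Real.pi * (2 * Real.pi * v) = (2 * v) ^ 2 by
      field_simp, Real.sqrt_sq (by positivity)]
  have e3 : √(2 * Real.pi * v) ≠ 0 := by positivity
  have e4 : √(2 * v / Real.pi) = 2 * v * (√(2 * Real.pi * v))⁻¹ := by
    rw [eq_mul_inv_iff_mul_eq₀ e3, e2]
  rw [e4]
  ring

lemma integrable_abs_gaussianReal (v : ℝ≥0) : Integrable (fun y => |y|) (gaussianReal 0 v) :=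
  ((memLp_id_gaussianReal (μ := 0) (v := v) 1).integrable le_rfl).abs

lemma integral_abs_gaussianReal (hv : v ≠ 0) :
    ∫ y, |y| ∂(gaussianReal 0 v) = √(2 * v / Real.pi) := by
  have h := integral_abs_tail_gaussianReal hv le_rfl
  simp only [ne_eq, OfNat.ofNat_ne_zero, not_false_eq_true, zero_pow, neg_zero, zero_div,
    Real.exp_zero, mul_one] at h
  rw [← h]
  refine integral_congr_ae (ae_of_all _ fun y => ?_)
  rcases eq_or_ne y 0 with rfl | hy
  · simp
  · simp [hy]

/-- Linearization of the overlap at short times, with an exponentially small error. -/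
lemma overlap_bounds (hr : 0 < r) (hσ : 0 < σ) (hv : v ≠ 0) :
    2 * r - σ * √(2 * v / Real.pi) ≤ overlap r σ v ∧
    overlap r σ v ≤ 2 * r - σ * √(2 * v / Real.pi)
      + σ * (√(2 * v / Real.pi) * Real.exp (-(2 * r / σ) ^ 2 / (2 * v))) := by
  have hI := integrable_abs_gaussianReal v
  have hlin : ∫ y, (2 * r - σ * |y|) ∂(gaussianReal 0 v) = 2 * r - σ * √(2 * v / Real.pi) := by
    rw [integral_sub (integrable_const _) (hI.const_mul _), integral_const_mul σ,
      integral_abs_gaussianReal hv]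
    simp
  have hlinI : Integrable (fun y => 2 * r - σ * |y|) (gaussianReal 0 v) :=
    (integrable_const _).sub (hI.const_mul _)
  have htail : Integrable (fun y => (Set.Ioi (2 * r / σ)).indicator id |y|) (gaussianReal 0 v) := by
    refine hI.mono' ?_ (ae_of_all _ fun y => ?_)
    · exact ((measurable_id.indicator measurableSet_Ioi).comp measurable_norm).aestronglyMeasurable
    · by_cases hy : |y| ∈ Set.Ioi (2 * r / σ)
      · simp [Set.indicator_of_mem hy]
      · simp [Set.indicator_of_notMem hy]
  -- The positive part dominates the linear function and agrees with it unless `|y| > 2r/σ`, where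
  -- the difference is at most `σ|y|`.
  constructor
  · rw [← hlin]
    exact integral_mono hlinI (integrable_overlap hσ _) fun y => le_max_left _ _
  · rw [← integral_abs_tail_gaussianReal hv (by positivity), ← hlin, ← integral_const_mul,
      ← integral_add hlinI (htail.const_mul _)]
    refine integral_mono (integrable_overlap hσ _) (hlinI.add (htail.const_mul _)) fun y => ?_
    by_cases hy : |y| ∈ Set.Ioi (2 * r / σ)
    · simp only [Set.indicator_of_mem hy, id]
      refine max_le ?_ ?_
      · have : 0 ≤ σ * |y| := by positivity
        linarith
      · linarith
    · simp only [Set.indicator_of_notMem hy, mul_zero, add_zero]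
      have h1 : |y| * σ ≤ 2 * r := by
        rw [← le_div_iff₀ hσ]
        exact not_lt.1 hy
      exact max_le le_rfl (by linarith)

lemma overlap_le (hr : 0 < r) (hσ : 0 < σ) (v : ℝ≥0) : overlap r σ v ≤ 2 * r := by
  calc overlap r σ v ≤ ∫ _, 2 * r ∂(gaussianReal 0 v) := by
        refine integral_mono (integrable_overlap hσ _) (integrable_const _) fun y => ?_
        have : 0 ≤ σ * |y| := by positivity
        exact max_le (by linarith) (by linarith)
    _ = 2 * r := by simp

/-- Decay of the overlap at long times. -/
lemma overlap_le_div_sqrt (hr : 0 < r) (hσ : 0 < σ) (hv : v ≠ 0) :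
    overlap r σ v ≤ 2 * r * (2 * (r / σ)) / √v := by
  have hv' : (0 : ℝ) < v := by positivity
  obtain ⟨I, hI⟩ : ∃ I, I = Set.Icc (-(2 * r / σ)) (2 * r / σ) := ⟨_, rfl⟩
  have hIm : MeasurableSet I := hI ▸ measurableSet_Icc
  -- The integrand is at most `2r` and vanishes off `I`. The Gaussian mass of `I` is then at most
  -- its length `4r/σ` times the maximal density.
  have h1 : overlap r σ v ≤ 2 * r * (gaussianReal 0 v).real I := by
    rw [mul_comm, ← smul_eq_mul, ← integral_indicator_const (2 * r) hIm]
    refine integral_mono (integrable_overlap hσ _)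
      ((integrable_const _).indicator hIm) fun y => ?_
    have h0 : 0 ≤ σ * |y| := by positivity
    by_cases hy : y ∈ I
    · simp only [Set.indicator_of_mem hy]
      exact max_le (by linarith) (by linarith)
    · simp only [Set.indicator_of_notMem hy]
      refine max_le ?_ le_rfl
      have : ¬ |y| ≤ 2 * r / σ := fun h => hy (hI ▸ Set.mem_Icc.2 (abs_le.1 h))
      rw [le_div_iff₀ hσ] at this
      linarith
  have h2 : (gaussianReal 0 v).real I ≤ (√(2 * Real.pi * v))⁻¹ * (4 * (r / σ)) := by
    rw [measureReal_def, gaussianReal_apply_eq_integral 0 hv, ENNReal.toReal_ofReal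
      (integral_nonneg fun x => gaussianPDFReal_nonneg _ _ _)]
    calc ∫ x in I, gaussianPDFReal 0 v x ≤ ∫ x in I, (√(2 * Real.pi * v))⁻¹ := by
          refine setIntegral_mono (integrable_gaussianPDFReal 0 v).integrableOn
            (integrableOn_const (by simp [hI])) fun x => ?_
          rw [gaussianPDFReal]
          refine mul_le_of_le_one_right (by positivity) (Real.exp_le_one_iff.2 ?_)
          exact div_nonpos_of_nonpos_of_nonneg (neg_nonpos.2 (sq_nonneg _)) (by positivity)
      _ = (√(2 * Real.pi * v))⁻¹ * (4 * (r / σ)) := by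
          rw [setIntegral_const, hI, Real.volume_real_Icc_of_le (by
            have : 0 ≤ 2 * r / σ := by positivity
            linarith), smul_eq_mul]
          ring
  have h3 : 2 * √(v : ℝ) ≤ √(2 * Real.pi * v) := by
    refine Real.le_sqrt_of_sq_le ?_
    rw [mul_pow, Real.sq_sqrt hv'.le]
    nlinarith [Real.pi_gt_three]
  have h4 : (√(2 * Real.pi * v))⁻¹ ≤ (2 * √(v : ℝ))⁻¹ := inv_anti₀ (by positivity) h3
  calc overlap r σ v ≤ 2 * r * ((2 * √(v : ℝ))⁻¹ * (4 * (r / σ))) := by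
        refine h1.trans (mul_le_mul_of_nonneg_left (h2.trans ?_) (by positivity))
        exact mul_le_mul_of_nonneg_right h4 (by positivity)
    _ = 2 * r * (2 * (r / σ)) / √v := by
        field_simp
        ring

end Overlap

/-! ### Joint measurability in time and outcome -/

section Measurability

variable {Ω : Type*} [MeasurableSpace Ω] {P : Measure Ω} {ξ : ℤ → Ω → ℝ} {lam : ℝ≥0}
  {W : ℤ → ℝ≥0 → Ω → ℝ} {r σ : ℝ}

/-- The Smoluchowski process is almost surely equal to a jointly measurable process. -/
lemma IsBrownianParticleSystem.exists_measurable_count (h : IsBrownianParticleSystem ξ W lam P)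
    (r σ : ℝ) : ∃ N : Ω → ℝ≥0 → ℝ, Measurable (Function.uncurry N) ∧
      ∀ᵐ ω ∂P, count ξ W r σ ω = N ω := by
  classical
  have hc : ∀ᵐ ω ∂P, ∀ j, Continuous fun t => W j t ω := ae_all_iff.2 fun j => (h.brownian j).cont
  obtain ⟨G, hGsub, hGm, hG0⟩ := exists_measurable_superset_of_null hc
  -- With every path made continuous by a change on a measurable null set, measurability at each
  -- fixed time implies joint measurability.
  let W' : ℤ → ℝ≥0 → Ω → ℝ := fun j t ω => if ω ∈ G then 0 else W j t ω
  have hWc : ∀ j ω, Continuous fun t => W' j t ω := by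
    intro j ω
    by_cases hω : ω ∈ G
    · simp only [W', if_pos hω]
      exact continuous_const
    · simp only [W', if_neg hω]
      have : ω ∉ {ω | ¬ ∀ j, Continuous fun t => W j t ω} := fun h' => hω (hGsub h')
      exact (not_not.1 this) j
  have hWm : ∀ j, Measurable fun p : Ω × ℝ≥0 => W' j p.2 p.1 := fun j =>
    (measurable_uncurry_of_continuous_of_measurable (hWc j) fun t =>
      Measurable.ite hGm measurable_const (h.measurable j t)).comp measurable_swap
  refine ⟨count ξ W' r σ, ?_, ?_⟩
  · refine Measurable.ennreal_toReal (Measurable.tsum fun j => ?_)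
    refine (measurable_const.indicator measurableSet_closedBall).comp ?_
    exact ((h.poisson.measurable j).comp measurable_fst).add ((hWm j).const_mul σ)
  · filter_upwards [measure_eq_zero_iff_ae_notMem.1 hG0] with ω hω
    ext t
    simp [count, position, W', hω]

end Measurability

/-! ### The truncated inverse-square-root kernel -/

section Kernel

lemma integrableOn_indicator_div_sqrt (D L : ℝ) :
    IntegrableOn ((Set.Iic L).indicator fun x => D / √x) (Set.Ioi 0) := by
  rcases le_or_gt L 0 with hL | hL
  · refine integrableOn_zero.congr_fun (fun x hx => ?_) measurableSet_Ioi
    rw [Set.indicator_of_notMem]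
    exact fun h => absurd (lt_of_lt_of_le hx h) (not_lt.2 hL)
  · rw [IntegrableOn, integrable_indicator_iff measurableSet_Iic, IntegrableOn,
      Measure.restrict_restrict measurableSet_Iic, Set.Iic_inter_Ioi]
    have h1 := (intervalIntegral.intervalIntegrable_rpow' (a := 0) (b := L)
      (r := -(1 / 2)) (by norm_num)).const_mul D
    rw [intervalIntegrable_iff_integrableOn_Ioc_of_le hL.le] at h1
    refine h1.congr_fun (fun x hx => ?_) measurableSet_Ioc
    simp only [Real.sqrt_eq_rpow, Real.rpow_neg hx.1.le]
    ring

lemma integral_Ioi_indicator_div_sqrt (D : ℝ) {L : ℝ} (hL : 0 ≤ L) :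
    ∫ x in Set.Ioi 0, (Set.Iic L).indicator (fun x => D / √x) x = 2 * D * √L := by
  rw [integral_indicator measurableSet_Iic, Measure.restrict_restrict measurableSet_Iic,
    Set.Iic_inter_Ioi]
  have h1 := integral_rpow (a := 0) (b := L) (r := -(1 / 2)) (.inl (by norm_num))
  rw [intervalIntegral.integral_of_le hL] at h1
  calc ∫ x in Set.Ioc 0 L, D / √x = ∫ x in Set.Ioc 0 L, D * x ^ (-(1 / 2) : ℝ) := by
        refine setIntegral_congr_fun measurableSet_Ioc fun x hx => ?_
        simp only [Real.sqrt_eq_rpow, Real.rpow_neg hx.1.le]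
        ring
    _ = 2 * D * √L := by
        rw [integral_const_mul, h1, Real.sqrt_eq_rpow]
        norm_num
        ring

lemma integrable_indicator_div_sqrt_abs (D L b : ℝ) :
    Integrable fun s : ℝ => (Set.Iic L).indicator (fun x => D / √x) |s + b| := by
  have h1 : Integrable fun s : ℝ => (Set.Iic L).indicator (fun x => D / √x) |s| := by
    have h0 := integrableOn_indicator_div_sqrt D L
    have hpos : IntegrableOn (fun s : ℝ => (Set.Iic L).indicator (fun x => D / √x) |s|)
        (Set.Ioi 0) :=
      h0.congr_fun (fun x hx => by simp only [abs_of_pos (Set.mem_Ioi.1 hx)]) measurableSet_Ioi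
    have hneg : IntegrableOn (fun s : ℝ => (Set.Iic L).indicator (fun x => D / √x) |s|)
        (Set.Iio 0) := by
      rw [← integrable_indicator_iff measurableSet_Iio]
      refine ((integrable_indicator_iff measurableSet_Ioi).2 hpos).comp_neg.congr
        (ae_of_all _ fun x => ?_)
      by_cases hx : x < 0 <;> simp [Set.indicator, hx]
    have hall := hneg.union ((integrableOn_singleton
      (hx := (by rw [Real.volume_singleton]; exact ENNReal.zero_lt_top : volume {(0 : ℝ)} < ∞))).union hpos)
    rw [← integrableOn_univ]
    refine hall.mono_set fun x _ => ?_
    rcases lt_trichotomy x 0 with h | h | h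
    · exact .inl h
    · exact .inr (.inl h)
    · exact .inr (.inr h)
  exact h1.comp_add_right b

/-- Extending the integral to the whole line makes it translation invariant, so the bound does not
depend on `b`. Each half-line contributes `2 D √L`. -/
lemma setIntegral_indicator_div_sqrt_abs_le {D L : ℝ} (hD : 0 ≤ D) (hL : 0 ≤ L) (b S : ℝ) :
    ∫ s in Set.Ioc 0 S, (Set.Iic L).indicator (fun x => D / √x) |s + b| ≤ 4 * D * √L := by
  calc ∫ s in Set.Ioc 0 S, (Set.Iic L).indicator (fun x => D / √x) |s + b|
      ≤ ∫ s : ℝ, (Set.Iic L).indicator (fun x => D / √x) |s + b| := by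
        refine setIntegral_le_integral (integrable_indicator_div_sqrt_abs D L b)
          (ae_of_all _ fun s => Set.indicator_nonneg (fun x _ => ?_) _)
        positivity
    _ = ∫ s : ℝ, (Set.Iic L).indicator (fun x => D / √x) |s| :=
        integral_add_right_eq_self (fun s : ℝ => (Set.Iic L).indicator (fun x => D / √x) |s|) b
    _ = 4 * D * √L := by
        rw [integral_comp_abs (f := (Set.Iic L).indicator fun x => D / √x),
          integral_Ioi_indicator_div_sqrt D hL]
        ring

end Kernel

/-! ### Mean square error of the covariance estimator -/

section Variance

variable {Ω : Type*} [MeasurableSpace Ω] {P : Measure Ω}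
  {X : Ω → ℝ≥0 → ℝ} {C : ℝ≥0 → ℝ} {ρ D : ℝ}

/-- `X` is a centred process with stationary covariance `C`, bounded by `ρ` and decaying at rate
`D / √t`, whose fourth joint cumulants are dominated by the covariance. -/
structure IsStationaryFourth (X : Ω → ℝ≥0 → ℝ) (C : ℝ≥0 → ℝ) (ρ D : ℝ) (P : Measure Ω) : Prop where
  measurable : Measurable (Function.uncurry X)
  cumulants : ∀ t : Fin 4 → ℝ≥0, ∃ κ₄ : Fin 4 → Fin 4 → Fin 4 → Fin 4 → ℝ,
    HasCumulants (fun i ω => X ω (t i)) (fun i j => C (nndist (t i) (t j))) κ₄ P ∧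
      ∀ i j k l, κ₄ i j k l ≤ C (nndist (t i) (t k))
  cov_nonneg : ∀ v, 0 ≤ C v
  cov_le : ∀ v, C v ≤ ρ
  cov_decay : ∀ v, v ≠ 0 → C v ≤ D / √v

lemma nndist_toNNReal_add {s τ : ℝ} (hs : 0 ≤ s) (hτ : 0 ≤ τ) :
    nndist s.toNNReal (s + τ).toNNReal = τ.toNNReal := by
  ext
  rw [coe_nndist, NNReal.dist_eq, Real.coe_toNNReal _ hs, Real.coe_toNNReal _ (by positivity),
    Real.coe_toNNReal _ hτ]
  simp [abs_of_nonneg hτ]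

/-- Equal times are excluded because `D / √0` is `0` by convention; in the integrals they form a
null set. -/
lemma IsStationaryFourth.cov_le_indicator (h : IsStationaryFourth X C ρ D P) {a b L : ℝ}
    (ha : 0 ≤ a) (hb : 0 ≤ b) (hab : a ≠ b) (hL : |a + -b| ≤ L) :
    C (nndist a.toNNReal b.toNNReal) ≤ (Set.Iic L).indicator (fun x => D / √x) |a + -b| := by
  have e : ((nndist a.toNNReal b.toNNReal : ℝ≥0) : ℝ) = |a + -b| := by
    rw [coe_nndist, NNReal.dist_eq, Real.coe_toNNReal _ ha, Real.coe_toNNReal _ hb, sub_eq_add_neg]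
  rw [Set.indicator_of_mem (by exact hL), ← e]
  refine h.cov_decay _ fun h0 => ?_
  rw [h0, NNReal.coe_zero, eq_comm, abs_eq_zero] at e
  exact hab (by linarith)

lemma IsStationaryFourth.memLp (h : IsStationaryFourth X C ρ D P) (t : ℝ≥0) :
    MemLp (fun ω => X ω t) 4 P := by
  obtain ⟨_, h1, _⟩ := h.cumulants fun _ => t
  exact h1.memLp 0

variable [IsProbabilityMeasure P]

lemma IsStationaryFourth.integrable_mul (h : IsStationaryFourth X C ρ D P) (s t : ℝ≥0) :
    Integrable (fun ω => X ω s * X ω t) P :=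
  ((h.memLp s).mono_exponent (p := 2) (by norm_num)).integrable_mul
    ((h.memLp t).mono_exponent (p := 2) (by norm_num))

lemma IsStationaryFourth.integrable_cov (h : IsStationaryFourth X C ρ D P) (s s' u u' : ℝ≥0)
    (c : ℝ) : Integrable (fun ω => (X ω s * X ω s' - c) * (X ω u * X ω u' - c)) P := by
  have e : ∀ ω, (X ω s * X ω s' - c) * (X ω u * X ω u' - c) = X ω s * X ω s' * X ω u * X ω u'
      - c * (X ω s * X ω s') - c * (X ω u * X ω u') + c ^ 2 := fun ω => by ring
  simp_rw [e]
  exact (((integrable_mul_of_memLp_four (h.memLp s) (h.memLp s') (h.memLp u) (h.memLp u')).sub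
    ((h.integrable_mul s s').const_mul c)).sub ((h.integrable_mul u u').const_mul c)).add
    (integrable_const _)

/-- Subtracting `c` cancels the pairing within each product. There remain the fourth cumulant and
two mixed pairings, in each of which one covariance is bounded by `ρ`. -/
lemma IsStationaryFourth.integral_cov_le (h : IsStationaryFourth X C ρ D P) {s s' u u' : ℝ≥0}
    {c : ℝ} (hs : C (nndist s s') = c) (hu : C (nndist u u') = c) :
    ∫ ω, (X ω s * X ω s' - c) * (X ω u * X ω u' - c) ∂P
      ≤ (1 + ρ) * C (nndist s u) + ρ * C (nndist s' u) := by
  obtain ⟨κ₄, h1, h2⟩ := h.cumulants ![s, s', u, u']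
  have i4 := integrable_mul_of_memLp_four (h.memLp s) (h.memLp s') (h.memLp u) (h.memLp u')
  have j1 := (h.integrable_mul s s').const_mul c
  have j2 := (h.integrable_mul u u').const_mul c
  have e : ∀ ω, (X ω s * X ω s' - c) * (X ω u * X ω u' - c) = X ω s * X ω s' * X ω u * X ω u'
      - c * (X ω s * X ω s') - c * (X ω u * X ω u') + c ^ 2 := fun ω => by ring
  simp_rw [e]
  rw [integral_add ((i4.sub' j1).sub' j2) (integrable_const _),
    integral_sub (i4.sub' j1) j2, integral_sub i4 j1, integral_const_mul, integral_const_mul]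
  have a1 := h1.second 0 1
  have a2 := h1.second 2 3
  have a3 := h1.fourth 0 1 2 3
  have a4 := h2 0 1 2 3
  simp only [Matrix.cons_val_zero, Matrix.cons_val_one, Matrix.cons_val, hs, hu] at a1 a2 a3 a4
  rw [a1, a2, a3]
  have b1 : C (nndist s u) * C (nndist s' u') ≤ C (nndist s u) * ρ :=
    mul_le_mul_of_nonneg_left (h.cov_le _) (h.cov_nonneg _)
  have b2 : C (nndist s u') * C (nndist s' u) ≤ ρ * C (nndist s' u) :=
    mul_le_mul_of_nonneg_right (h.cov_le _) (h.cov_nonneg _)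
  simp only [integral_const, probReal_univ, smul_eq_mul, one_mul]
  nlinarith

lemma IsStationaryFourth.integral_sq_le (h : IsStationaryFourth X C ρ D P) {s s' : ℝ≥0}
    {c : ℝ} (hs : C (nndist s s') = c) :
    ∫ ω, (X ω s * X ω s' - c) * (X ω s * X ω s' - c) ∂P ≤ (1 + 2 * ρ) * ρ := by
  refine (h.integral_cov_le hs hs).trans ?_
  have h0 : 0 ≤ ρ := (h.cov_nonneg 0).trans (h.cov_le 0)
  have b1 : (1 + ρ) * C (nndist s s) ≤ (1 + ρ) * ρ :=
    mul_le_mul_of_nonneg_left (h.cov_le _) (by positivity)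
  have b2 : ρ * C (nndist s' s) ≤ ρ * ρ := mul_le_mul_of_nonneg_left (h.cov_le _) h0
  linarith

/-- This crude uniform bound, from `|ab| ≤ (a² + b²)/2`, serves only to justify Fubini. -/
lemma IsStationaryFourth.integral_abs_cov_le (h : IsStationaryFourth X C ρ D P) {s s' u u' : ℝ≥0}
    {c : ℝ} (hs : C (nndist s s') = c) (hu : C (nndist u u') = c) :
    ∫ ω, ‖(X ω s * X ω s' - c) * (X ω u * X ω u' - c)‖ ∂P ≤ (1 + 2 * ρ) * ρ := by
  have i1 := h.integrable_cov s s' s s' c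
  have i2 := h.integrable_cov u u' u u' c
  calc ∫ ω, ‖(X ω s * X ω s' - c) * (X ω u * X ω u' - c)‖ ∂P
      ≤ ∫ ω, (2⁻¹ * ((X ω s * X ω s' - c) * (X ω s * X ω s' - c))
        + 2⁻¹ * ((X ω u * X ω u' - c) * (X ω u * X ω u' - c))) ∂P := by
        refine integral_mono (h.integrable_cov s s' u u' c).norm
          ((i1.const_mul _).add (i2.const_mul _)) fun ω => ?_
        simp only [Real.norm_eq_abs]
        refine abs_le.2 ⟨?_, ?_⟩
        · nlinarith [sq_nonneg ((X ω s * X ω s' - c) + (X ω u * X ω u' - c))]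
        · nlinarith [sq_nonneg ((X ω s * X ω s' - c) - (X ω u * X ω u' - c))]
    _ ≤ (1 + 2 * ρ) * ρ := by
        rw [integral_add (i1.const_mul _) (i2.const_mul _), integral_const_mul, integral_const_mul]
        have := h.integral_sq_le hs
        have := h.integral_sq_le hu
        linarith

/-- The mean square error of the covariance estimator. -/
theorem IsStationaryFourth.variance_le (h : IsStationaryFourth X C ρ D P) {S τ : ℝ} (hS : 0 < S)
    (hτ : 0 ≤ τ) (hD : 0 ≤ D) :
    MemLp (fun ω => 1 / S * (∫ s in (0 : ℝ)..S, X ω s.toNNReal * X ω (s + τ).toNNReal)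
      - C τ.toNNReal) 2 P ∧
    ∫ ω, (1 / S * (∫ s in (0 : ℝ)..S, X ω s.toNNReal * X ω (s + τ).toNNReal)
      - C τ.toNNReal) ^ 2 ∂P ≤ (1 + 2 * ρ) * (4 * D * √(S + τ)) / S := by
  have hρ : 0 ≤ ρ := (h.cov_nonneg 0).trans (h.cov_le 0)
  set c := C τ.toNNReal with hc
  set ν : Measure ℝ := volume.restrict (Set.Ioc 0 S) with hν
  have hνfin : IsFiniteMeasure ν := by
    rw [hν]; exact isFiniteMeasure_restrict.2 (by simp)
  have hνreal : ν.real Set.univ = S := by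
    rw [hν, measureReal_restrict_apply_univ, Real.volume_real_Ioc_of_le hS.le, sub_zero]
  let g : Ω → ℝ → ℝ := fun ω s => X ω s.toNNReal * X ω (s + τ).toNNReal - c
  have hgm : Measurable (Function.uncurry g) := by
    have m1 : Measurable fun p : Ω × ℝ => (p.1, p.2.toNNReal) := by fun_prop
    have m2 : Measurable fun p : Ω × ℝ => (p.1, (p.2 + τ).toNNReal) := by fun_prop
    exact ((h.measurable.comp m1).mul (h.measurable.comp m2)).sub measurable_const
  have hmem : ∀ᵐ s ∂ν, s ∈ Set.Ioc 0 S := ae_restrict_mem measurableSet_Ioc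
  have hmem2 : ∀ᵐ p ∂(ν.prod ν), p.1 ∈ Set.Ioc 0 S ∧ p.2 ∈ Set.Ioc 0 S := by
    rw [hν, Measure.prod_restrict]
    exact ae_restrict_mem (measurableSet_Ioc.prod measurableSet_Ioc)
  have hcs : ∀ s : ℝ, 0 < s → C (nndist s.toNNReal (s + τ).toNNReal) = c := fun s hs => by
    rw [nndist_toNNReal_add hs.le hτ]
  let f : Ω × (ℝ × ℝ) → ℝ := fun p => g p.1 p.2.1 * g p.1 p.2.2
  have hfm : Measurable f := by
    have m1 : Measurable fun p : Ω × (ℝ × ℝ) => (p.1, p.2.1) := by fun_prop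
    have m2 : Measurable fun p : Ω × (ℝ × ℝ) => (p.1, p.2.2) := by fun_prop
    exact (hgm.comp m1).mul (hgm.comp m2)
  have hf : Integrable f (P.prod (ν.prod ν)) := by
    rw [integrable_prod_iff' hfm.aestronglyMeasurable]
    refine ⟨ae_of_all _ fun p => h.integrable_cov p.1.toNNReal (p.1 + τ).toNNReal p.2.toNNReal
      (p.2 + τ).toNNReal c, ?_⟩
    refine Integrable.of_bound (C := (1 + 2 * ρ) * ρ)
      hfm.stronglyMeasurable.norm.integral_prod_left'.aestronglyMeasurable ?_
    filter_upwards [hmem2] with p hp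
    rw [Real.norm_eq_abs, abs_of_nonneg (integral_nonneg fun _ => norm_nonneg _)]
    exact h.integral_abs_cov_le (hcs _ hp.1.1) (hcs _ hp.2.1)
  have hg : Integrable (Function.uncurry g) (P.prod ν) := by
    rw [integrable_prod_iff' hgm.aestronglyMeasurable]
    have hi : ∀ s, Integrable (fun ω => g ω s) P := fun s =>
      (h.integrable_mul _ _).sub (integrable_const _)
    refine ⟨ae_of_all _ hi, ?_⟩
    refine Integrable.of_bound (C := 1 + (1 + 2 * ρ) * ρ)
      hgm.stronglyMeasurable.norm.integral_prod_left'.aestronglyMeasurable ?_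
    filter_upwards [hmem] with s hs
    rw [Real.norm_eq_abs, abs_of_nonneg (integral_nonneg fun _ => norm_nonneg _)]
    have i1 := h.integrable_cov s.toNNReal (s + τ).toNNReal s.toNNReal (s + τ).toNNReal c
    calc ∫ ω, ‖g ω s‖ ∂P ≤ ∫ ω, (1 + g ω s * g ω s) ∂P := by
          refine integral_mono (hi s).norm ((integrable_const _).add i1) fun ω => ?_
          simp only [Real.norm_eq_abs]
          nlinarith [sq_nonneg (|g ω s| - 1), abs_mul_abs_self (g ω s), sq_nonneg (|g ω s|)]
      _ = 1 + ∫ ω, g ω s * g ω s ∂P := by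
          rw [integral_add (integrable_const _) i1, integral_const, probReal_univ, one_smul]
      _ ≤ _ := by
          have := h.integral_sq_le (hcs s hs.1)
          gcongr
  let G : Ω → ℝ := fun ω => ∫ s, g ω s ∂ν
  have hGm : StronglyMeasurable G := hgm.stronglyMeasurable.integral_prod_right
  have hGsq : ∀ ω, G ω ^ 2 = ∫ p, f (ω, p) ∂(ν.prod ν) := fun ω => by
    rw [sq]
    exact (integral_prod_mul (μ := ν) (ν := ν) (g ω) (g ω)).symm
  -- Splitting off the constant needs an integrable path, which Fubini provides for almost every
  -- outcome.
  have hRG : ∀ᵐ ω ∂P, 1 / S * (∫ s in (0 : ℝ)..S, X ω s.toNNReal * X ω (s + τ).toNNReal) - c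
      = S⁻¹ * G ω := by
    filter_upwards [hg.prod_right_ae] with ω hω
    have h1 : Integrable (fun s => g ω s) ν := hω
    have h2 : G ω = (∫ s in (0 : ℝ)..S, X ω s.toNNReal * X ω (s + τ).toNNReal) - S * c := by
      have e : ∀ s, X ω s.toNNReal * X ω (s + τ).toNNReal = g ω s + c := fun s => by simp [g]
      rw [intervalIntegral.integral_of_le hS.le]
      simp_rw [e]
      rw [integral_add h1 (integrable_const _), integral_const, hνreal, smul_eq_mul]
      simp [G]
    rw [h2]
    field_simp
  have hGint : Integrable (fun ω => G ω ^ 2) P := by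
    simp_rw [hGsq]
    exact hf.integral_prod_left
  have hGL : MemLp G 2 P := (memLp_two_iff_integrable_sq hGm.aestronglyMeasurable).2 hGint
  refine ⟨(memLp_congr_ae hRG).2 (hGL.const_mul _), ?_⟩
  have hbound : ∫ ω, G ω ^ 2 ∂P ≤ S * ((1 + 2 * ρ) * (4 * D * √(S + τ))) := by
    let φ : ℝ × ℝ → ℝ := fun p => ∫ ω, f (ω, p) ∂P
    have hφ : Integrable φ (ν.prod ν) := hf.integral_prod_right
    have e1 : ∫ ω, G ω ^ 2 ∂P = ∫ u, ∫ s, φ (s, u) ∂ν ∂ν := by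
      rw [← integral_prod_symm φ hφ]
      simp_rw [hGsq]
      exact integral_integral_swap (f := fun ω p => f (ω, p)) hf
    rw [e1]
    -- For fixed `u` the covariance bound has two kernels in `s`, singular at `u` and at `u - τ`.
    -- Both distances `|s - u|` and `|s + τ - u|` are at most `S + τ`, whence the truncation level.
    have hin : ∀ᵐ u ∂ν, ∫ s, φ (s, u) ∂ν ≤ (1 + 2 * ρ) * (4 * D * √(S + τ)) := by
      filter_upwards [hφ.prod_left_ae, hmem] with u hu hu'
      let k : ℝ → ℝ := (Set.Iic (S + τ)).indicator fun x => D / √x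
      have k1 : Integrable (fun s => k |s + -u|) ν :=
        (integrable_indicator_div_sqrt_abs D (S + τ) (-u)).integrableOn
      have k2 : Integrable (fun s => k |s + (τ - u)|) ν :=
        (integrable_indicator_div_sqrt_abs D (S + τ) (τ - u)).integrableOn
      have hne : ∀ a : ℝ, ∀ᵐ s ∂ν, s ≠ a := fun a =>
        ae_restrict_of_ae (by simp [ae_iff])
      calc ∫ s, φ (s, u) ∂ν ≤ ∫ s, ((1 + ρ) * k |s + -u| + ρ * k |s + (τ - u)|) ∂ν := by
            refine integral_mono_ae hu ((k1.const_mul _).add (k2.const_mul _)) ?_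
            filter_upwards [hmem, hne u, hne (u - τ)] with s hs hsu hsu'
            refine (h.integral_cov_le (hcs s hs.1) (hcs u hu'.1)).trans ?_
            have b1 := h.cov_le_indicator (a := s) (b := u) (L := S + τ) hs.1.le hu'.1.le hsu
              (abs_le.2 ⟨by linarith [hs.1, hu'.2], by linarith [hs.2, hu'.1]⟩)
            have b2 := h.cov_le_indicator (a := s + τ) (b := u) (L := S + τ) (by linarith [hs.1])
              hu'.1.le (fun h => hsu' (by linarith))
              (abs_le.2 ⟨by linarith [hs.1, hu'.2], by linarith [hs.2, hu'.1]⟩)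
            rw [show s + τ + -u = s + (τ - u) by ring] at b2
            exact add_le_add (mul_le_mul_of_nonneg_left b1 (by positivity))
              (mul_le_mul_of_nonneg_left b2 hρ)
        _ = (1 + ρ) * (∫ s, k |s + -u| ∂ν) + ρ * ∫ s, k |s + (τ - u)| ∂ν := by
            rw [integral_add (k1.const_mul _) (k2.const_mul _), integral_const_mul,
              integral_const_mul]
        _ ≤ (1 + ρ) * (4 * D * √(S + τ)) + ρ * (4 * D * √(S + τ)) :=
            add_le_add (mul_le_mul_of_nonneg_left
              (setIntegral_indicator_div_sqrt_abs_le hD (by positivity) _ _) (by positivity))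
              (mul_le_mul_of_nonneg_left
              (setIntegral_indicator_div_sqrt_abs_le hD (by positivity) _ _) hρ)
        _ = _ := by ring
    calc ∫ u, ∫ s, φ (s, u) ∂ν ∂ν ≤ ∫ _, (1 + 2 * ρ) * (4 * D * √(S + τ)) ∂ν :=
          integral_mono_ae hφ.integral_prod_right (integrable_const _) hin
      _ = _ := by rw [integral_const, hνreal, smul_eq_mul]
  have e2 : ∫ ω, (1 / S * (∫ s in (0 : ℝ)..S, X ω s.toNNReal * X ω (s + τ).toNNReal) - c) ^ 2 ∂P
      = S⁻¹ ^ 2 * ∫ ω, G ω ^ 2 ∂P := by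
    rw [← integral_const_mul]
    refine integral_congr_ae ?_
    filter_upwards [hRG] with ω hω
    rw [hω, mul_pow]
  rw [e2]
  calc S⁻¹ ^ 2 * ∫ ω, G ω ^ 2 ∂P ≤ S⁻¹ ^ 2 * (S * ((1 + 2 * ρ) * (4 * D * √(S + τ)))) :=
        mul_le_mul_of_nonneg_left hbound (by positivity)
    _ = _ := by field_simp

end Variance

/-! ### Variance and bias of the diffusion estimator -/

section

variable {Ω : Type*} [MeasurableSpace Ω] {P : Measure Ω}
  {ξ : ℤ → Ω → ℝ} {W : ℤ → ℝ≥0 → Ω → ℝ} {lam : ℝ≥0} {r σ : ℝ}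

lemma HasCumulants.congr {ι : Type*} {S S' : ι → Ω → ℝ} {κ₂ : ι → ι → ℝ}
    {κ₄ : ι → ι → ι → ι → ℝ} {P : Measure Ω} (h : HasCumulants S κ₂ κ₄ P)
    (hS' : ∀ i, Measurable (S' i)) (hSS' : ∀ i, S i =ᵐ[P] S' i) : HasCumulants S' κ₂ κ₄ P where
  measurable := hS'
  memLp i := (memLp_congr_ae (hSS' i)).1 (h.memLp i)
  first i := by rw [← h.first i]; exact integral_congr_ae (hSS' i).symm
  second i j := by
    rw [← h.second i j]
    exact integral_congr_ae ((hSS' i).symm.mul (hSS' j).symm)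
  fourth i j k l := by
    rw [← h.fourth i j k l]
    exact integral_congr_ae ((((hSS' i).symm.mul (hSS' j).symm).mul (hSS' k).symm).mul
      (hSS' l).symm)

variable [IsProbabilityMeasure P]

lemma IsBrownianParticleSystem.isStationaryFourth (h : IsBrownianParticleSystem ξ W lam P)
    (hr : 0 < r) (hσ : 0 < σ) {N : Ω → ℝ≥0 → ℝ} (hN : Measurable (Function.uncurry N))
    (hcN : ∀ᵐ ω ∂P, count ξ W r σ ω = N ω) :
    IsStationaryFourth (fun ω t => N ω t - meanCount lam r) (fun v => lam * overlap r σ v)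
      (meanCount lam r) (meanCount lam r * (2 * (r / σ))) P where
  measurable := hN.sub measurable_const
  cumulants t := by
    obtain ⟨κ₄, h1, h2⟩ := h.hasCumulants_count hr hσ t
    refine ⟨κ₄, h1.congr (fun i => ?_) (fun i => ?_), h2⟩
    · exact (hN.comp measurable_prodMk_right).sub measurable_const
    · filter_upwards [hcN] with ω hω
      rw [hω]
  cov_nonneg v := mul_nonneg lam.2 (overlap_nonneg _ _ _)
  cov_le v := by
    rw [meanCount_eq lam hr]
    exact mul_le_mul_of_nonneg_left (overlap_le hr hσ v) lam.2
  cov_decay v hv := by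
    rw [meanCount_eq lam hr, mul_assoc, mul_div_assoc]
    exact mul_le_mul_of_nonneg_left (overlap_le_div_sqrt hr hσ hv) lam.2

/-- The covariance estimator is unbiased with mean square error of order `(r / σ) / √T`. -/
lemma IsBrownianParticleSystem.covEstimator_error (h : IsBrownianParticleSystem ξ W lam P)
    (hr : 0 < r) (hσ : 0 < σ) {T τ : ℝ} (hτ : 0 ≤ τ) (hT : 0 < T) (hτT : τ ≤ T / 2) :
    MemLp (fun ω => covEstimator (meanCount lam r) T (count ξ W r σ ω) τ
      - lam * overlap r σ τ.toNNReal) 2 P ∧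
    ∫ ω, (covEstimator (meanCount lam r) T (count ξ W r σ ω) τ
      - lam * overlap r σ τ.toNNReal) ^ 2 ∂P
      ≤ (1 + 2 * meanCount lam r) * meanCount lam r * (16 * (r / σ)) / √T := by
  obtain ⟨N, hN, hcN⟩ := h.exists_measurable_count r σ
  have hρ : 0 ≤ meanCount lam r := by rw [meanCount_eq lam hr]; positivity
  have hS : 0 < T - τ := by linarith
  obtain ⟨h1, h2⟩ := (h.isStationaryFourth hr hσ hN hcN).variance_le hS hτ (by positivity)
  have hae : ∀ᵐ ω ∂P, covEstimator (meanCount lam r) T (count ξ W r σ ω) τ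
      - lam * overlap r σ τ.toNNReal
      = 1 / (T - τ) * (∫ s in (0 : ℝ)..(T - τ), (N ω s.toNNReal - meanCount lam r) *
        (N ω (s + τ).toNNReal - meanCount lam r)) - lam * overlap r σ τ.toNNReal := by
    filter_upwards [hcN] with ω hω
    rw [hω, covEstimator]
  refine ⟨(memLp_congr_ae hae).2 h1, ?_⟩
  refine (integral_congr_ae (hae.mono fun ω hω => congrArg (· ^ 2) hω)).trans_le (h2.trans ?_)
  rw [sub_add_cancel]
  set ρ := meanCount lam r
  -- Since `τ ≤ T/2`, the averaging window has length at least `T/2`.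
  have hsq : √T / (T - τ) ≤ 2 / √T := by
    rw [div_le_div_iff₀ hS (by positivity), Real.mul_self_sqrt hT.le]
    linarith
  calc (1 + 2 * ρ) * (4 * (ρ * (2 * (r / σ))) * √T) / (T - τ)
      = (1 + 2 * ρ) * ρ * (8 * (r / σ)) * (√T / (T - τ)) := by ring
    _ ≤ (1 + 2 * ρ) * ρ * (8 * (r / σ)) * (2 / √T) :=
        mul_le_mul_of_nonneg_left hsq (by positivity)
    _ = _ := by ring

/-- The bias of the estimator of the diffusion coefficient. -/
lemma bias_bounds {σbar T : ℝ} (hr : 0 < r) (hσ : 0 < σ) (hσbar : σ ≤ σbar) (hT : 1 < T) :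
    0 ≤ σ - √(2 * Real.pi) * r / √(tauStar r σbar T) *
      (1 - overlap r σ (tauStar r σbar T).toNNReal / (2 * r)) ∧
    σ - √(2 * Real.pi) * r / √(tauStar r σbar T) *
      (1 - overlap r σ (tauStar r σbar T).toNNReal / (2 * r)) ≤ σ / √T := by
  have hlog : 0 < Real.log T := Real.log_pos hT
  have hsb : 0 < σbar := hσ.trans_le hσbar
  obtain ⟨τ, hτdef⟩ : ∃ τ, τ = tauStar r σbar T := ⟨_, rfl⟩
  have hτ : 0 < τ := by rw [hτdef, tauStar]; positivity
  rw [← hτdef]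
  have hτ' : ((τ.toNNReal : ℝ≥0) : ℝ) = τ := Real.coe_toNNReal _ hτ.le
  obtain ⟨h1, h2⟩ := overlap_bounds hr hσ (v := τ.toNNReal) (by simpa using hτ)
  rw [hτ'] at h1 h2
  set o := overlap r σ τ.toNNReal
  -- This normalisation makes the linearised overlap return `σ` exactly, so the bias is `a/2` times
  -- the linearisation error.
  have hA : √(2 * Real.pi) / √τ * √(2 * τ / Real.pi) = 2 := by
    rw [div_mul_eq_mul_div, ← Real.sqrt_mul (by positivity), ← Real.sqrt_div (by positivity),
      show 2 * Real.pi * (2 * τ / Real.pi) / τ = 2 ^ 2 by field_simp,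
      Real.sqrt_sq (by norm_num)]
  set a := √(2 * Real.pi) / √τ
  set b := √(2 * τ / Real.pi)
  have ha : 0 < a := by positivity
  have e1 : σ - √(2 * Real.pi) * r / √τ * (1 - o / (2 * r)) = a / 2 * (o - (2 * r - σ * b)) := by
    have : σ = a * b * σ / 2 := by rw [hA]; ring
    have e2 : √(2 * Real.pi) * r / √τ * (1 - o / (2 * r)) = a * (2 * r - o) / 2 := by
      simp only [a]; field_simp
    rw [e2]
    linarith
  rw [e1]
  refine ⟨mul_nonneg (by positivity) (by linarith), ?_⟩
  -- At `τ_*` the exponent is `-(σbar/σ)² (ln T)/2`, at most `-(ln T)/2` because `σ ≤ σbar`.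
  have hexp : Real.exp (-(2 * r / σ) ^ 2 / (2 * τ)) ≤ 1 / √T := by
    have h3 : 1 / √T = Real.exp (-(Real.log T / 2)) := by
      rw [Real.exp_neg, Real.exp_half, Real.exp_log (by linarith), one_div]
    rw [h3]
    refine Real.exp_le_exp.2 ?_
    have h4 : -(2 * r / σ) ^ 2 / (2 * τ) = -((σbar / σ) ^ 2 * (Real.log T / 2)) := by
      rw [hτdef, tauStar]; field_simp; norm_num
    rw [h4, neg_le_neg_iff]
    have h5 : 1 ≤ σbar / σ := (one_le_div hσ).2 hσbar
    exact le_mul_of_one_le_left (by positivity) (one_le_pow₀ h5)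
  calc a / 2 * (o - (2 * r - σ * b))
      ≤ a / 2 * (σ * (b * Real.exp (-(2 * r / σ) ^ 2 / (2 * τ)))) :=
        mul_le_mul_of_nonneg_left (by linarith) (by positivity)
    _ = a * b / 2 * σ * Real.exp (-(2 * r / σ) ^ 2 / (2 * τ)) := by ring
    _ = σ * Real.exp (-(2 * r / σ) ^ 2 / (2 * τ)) := by rw [hA]; ring
    _ ≤ σ * (1 / √T) := mul_le_mul_of_nonneg_left hexp hσ.le
    _ = σ / √T := by ring

lemma tauStar_bounds {σbar T : ℝ} (hr : 0 < r) (hsb : 0 < σbar) (hT1 : Real.exp 1 ≤ T)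
    (hT2 : 8 * r ^ 2 / σbar ^ 2 ≤ T) : 0 < tauStar r σbar T ∧ tauStar r σbar T ≤ T / 2 := by
  have hlog : 1 ≤ Real.log T := (Real.le_log_iff_exp_le ((Real.exp_pos 1).trans_le hT1)).2 hT1
  refine ⟨by rw [tauStar]; positivity, ?_⟩
  calc tauStar r σbar T ≤ 4 * r ^ 2 / (σbar ^ 2 * 1) := by rw [tauStar]; gcongr
    _ = (8 * r ^ 2 / σbar ^ 2) / 2 := by ring
    _ ≤ T / 2 := by gcongr

/-- Mean square error of the estimator of the diffusion coefficient built from any estimator of the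
covariance which is at least as accurate as the empirical one. -/
lemma IsBrownianParticleSystem.sigmaEstimator_error (h : IsBrownianParticleSystem ξ W lam P)
    {σbar T : ℝ} (hr : 0 < r) (hσ : 0 < σ) (hσbar : σ ≤ σbar) (hlam : 0 < lam)
    (hT1 : Real.exp 1 ≤ T) (hT2 : 8 * r ^ 2 / σbar ^ 2 ≤ T) (hT3 : (2 * σbar / r) ^ 2 ≤ T)
    {Y : Ω → ℝ} (hY : AEStronglyMeasurable Y P)
    (hYR : ∀ ω, |Y ω - lam * overlap r σ (tauStar r σbar T).toNNReal|
      ≤ |covEstimator (meanCount lam r) T (count ξ W r σ ω) (tauStar r σbar T)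
        - lam * overlap r σ (tauStar r σbar T).toNNReal|)
    {Hhat : Ω → ℝ → ℝ} (hH : ∀ ω, Hhat ω (tauStar r σbar T) = Y ω / meanCount lam r) :
    MemLp (fun ω => sigmaEstimator r (Hhat ω) (tauStar r σbar T) - σ) 2 P ∧
    ∫ ω, |sigmaEstimator r (Hhat ω) (tauStar r σbar T) - σ| ^ 2 ∂P
      ≤ (32 * Real.pi + 1) * (1 + 1 / meanCount lam r) * (r / σ) *
        (σbar ^ 2 * Real.log T / √T) := by
  have hsb : 0 < σbar := hσ.trans_le hσbar
  have hT0 : 0 < T := (Real.exp_pos 1).trans_le hT1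
  have hTone : 1 < T := (Real.one_lt_exp_iff.2 one_pos).trans_le hT1
  have hlog : 1 ≤ Real.log T := (Real.le_log_iff_exp_le hT0).2 hT1
  obtain ⟨hb0, hb1⟩ := bias_bounds hr hσ hσbar hTone
  obtain ⟨hτ, hτT⟩ := tauStar_bounds hr hsb hT1 hT2
  have hτdef : tauStar r σbar T = 4 * r ^ 2 / (σbar ^ 2 * Real.log T) := rfl
  set τ := tauStar r σbar T
  obtain ⟨hR, hRsq⟩ := h.covEstimator_error hr hσ hτ.le hT0 hτT
  have hρdef := meanCount_eq lam hr
  have hlam' : (0 : ℝ) < lam := hlam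
  set ρ := meanCount lam r
  have hρ : 0 < ρ := by rw [hρdef]; positivity
  set o := overlap r σ τ.toNNReal
  set c := lam * o with hc
  have hcρ : o / (2 * r) = c / ρ := by rw [hc, hρdef]; field_simp
  rw [hcρ] at hb0 hb1
  set A := √(2 * Real.pi) * r / √τ with hAdef
  set R := fun ω => covEstimator ρ T (count ξ W r σ ω) τ - c
  have hYL : MemLp (fun ω => Y ω - c) 2 P :=
    hR.mono (hY.sub aestronglyMeasurable_const) (ae_of_all _ hYR)
  have hest : ∀ ω, sigmaEstimator r (Hhat ω) τ - σ
      = -(A / ρ) * (Y ω - c) - (σ - A * (1 - c / ρ)) := by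
    intro ω
    rw [sigmaEstimator, hH]
    ring
  have hML : MemLp (fun ω => sigmaEstimator r (Hhat ω) τ - σ) 2 P := by
    simp_rw [hest]
    exact (hYL.const_mul _).sub (memLp_const _)
  refine ⟨hML, ?_⟩
  set β := σ - A * (1 - c / ρ)
  have hA2 : A ^ 2 = Real.pi / 2 * (σbar ^ 2 * Real.log T) := by
    rw [hAdef, div_pow, mul_pow, Real.sq_sqrt (by positivity), Real.sq_sqrt hτ.le, hτdef]
    field_simp
    ring
  have hRint : Integrable (fun ω => R ω ^ 2) P := hR.integrable_sq
  have hpt : ∀ ω, |sigmaEstimator r (Hhat ω) τ - σ| ^ 2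
      ≤ 2 * (A ^ 2 / ρ ^ 2) * R ω ^ 2 + 2 * (σ ^ 2 / T) := by
    intro ω
    rw [sq_abs, hest]
    have h1 : (Y ω - c) ^ 2 ≤ R ω ^ 2 := sq_le_sq.2 (hYR ω)
    have h2 : β ^ 2 ≤ σ ^ 2 / T := by
      calc β ^ 2 ≤ (σ / √T) ^ 2 := pow_le_pow_left₀ hb0 hb1 2
        _ = σ ^ 2 / T := by rw [div_pow, Real.sq_sqrt hT0.le]
    have h3 : A ^ 2 / ρ ^ 2 * (Y ω - c) ^ 2 ≤ A ^ 2 / ρ ^ 2 * R ω ^ 2 :=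
      mul_le_mul_of_nonneg_left h1 (by positivity)
    have h4 : (-(A / ρ) * (Y ω - c)) ^ 2 = A ^ 2 / ρ ^ 2 * (Y ω - c) ^ 2 := by ring
    nlinarith [sq_nonneg (-(A / ρ) * (Y ω - c) + β)]
  have hint : ∫ ω, |sigmaEstimator r (Hhat ω) τ - σ| ^ 2 ∂P
      ≤ 2 * (A ^ 2 / ρ ^ 2) * (∫ ω, R ω ^ 2 ∂P) + 2 * (σ ^ 2 / T) := by
    calc ∫ ω, |sigmaEstimator r (Hhat ω) τ - σ| ^ 2 ∂P
        ≤ ∫ ω, (2 * (A ^ 2 / ρ ^ 2) * R ω ^ 2 + 2 * (σ ^ 2 / T)) ∂P := by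
          refine integral_mono ?_ ((hRint.const_mul _).add (integrable_const _)) hpt
          simp_rw [sq_abs]
          exact hML.integrable_sq
      _ = _ := by
          rw [integral_add (hRint.const_mul _) (integrable_const _), integral_const_mul,
            integral_const, probReal_univ, one_smul]
  refine hint.trans ?_
  set B := r / σ * (σbar ^ 2 * Real.log T / √T) with hB
  have hB0 : 0 ≤ B := by positivity
  have hvar : 2 * (A ^ 2 / ρ ^ 2) * (∫ ω, R ω ^ 2 ∂P) ≤ 32 * Real.pi * (1 + 1 / ρ) * B := by
    calc 2 * (A ^ 2 / ρ ^ 2) * (∫ ω, R ω ^ 2 ∂P)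
        ≤ 2 * (A ^ 2 / ρ ^ 2) * ((1 + 2 * ρ) * ρ * (16 * (r / σ)) / √T) :=
          mul_le_mul_of_nonneg_left hRsq (by positivity)
      _ = 16 * Real.pi * (2 + 1 / ρ) * B := by
          rw [hA2, hB]
          field_simp
          ring
      _ ≤ 32 * Real.pi * (1 + 1 / ρ) * B := by
          refine mul_le_mul_of_nonneg_right ?_ hB0
          have : 0 ≤ Real.pi * (1 / ρ) := by positivity
          nlinarith
  have hbias : 2 * (σ ^ 2 / T) ≤ (1 + 1 / ρ) * B := by
    -- The condition `(2 σbar / r)² ≤ T` gives `2σ ≤ r √T`; together with `ln T ≥ 1` this absorbs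
    -- the squared bias.
    have h1 : 2 * (σ ^ 2 / T) ≤ B := by
      have hs : 2 * σbar / r ≤ √T := Real.le_sqrt_of_sq_le hT3
      have hs' : 2 * σbar ≤ √T * r := (div_le_iff₀ hr).1 hs
      have hsT : 0 < √T := by positivity
      have hTT : T = √T * √T := (Real.mul_self_sqrt hT0.le).symm
      calc 2 * (σ ^ 2 / T) = (2 * σ) * σ ^ 2 / (√T * √T * σ) := by
            rw [← hTT]; field_simp
        _ ≤ (√T * r) * (σbar ^ 2 * Real.log T) / (√T * √T * σ) := by
            refine div_le_div_of_nonneg_right ?_ (by positivity)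
            refine mul_le_mul (by linarith) ?_ (by positivity) (by positivity)
            calc σ ^ 2 ≤ σbar ^ 2 := pow_le_pow_left₀ hσ.le hσbar 2
              _ ≤ σbar ^ 2 * Real.log T := le_mul_of_one_le_right (by positivity) hlog
        _ = B := by rw [hB]; field_simp
    exact h1.trans (le_mul_of_one_le_left hB0 (by
      have : 0 ≤ 1 / ρ := by positivity
      linarith))
  calc _ ≤ 32 * Real.pi * (1 + 1 / ρ) * B + (1 + 1 / ρ) * B := add_le_add hvar hbias
    _ = _ := by rw [hB]; ring

end

end Smoluchowski

theorem mainTheorem8 :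
    ∃ c : ℝ, 0 < c ∧
      ∀ r σbar : ℝ, 0 < r → 0 < σbar →
        ∃ T₀ : ℝ, ∀ T : ℝ, T₀ ≤ T →
          ∀ (σ : ℝ) (lam : ℝ≥0), 0 < σ → σ ≤ σbar → 0 < lam →
            ∀ (Ω : Type u) [MeasurableSpace Ω] (P : Measure Ω) [IsProbabilityMeasure P]
              (ξ : ℤ → Ω → ℝ) (W : ℤ → ℝ≥0 → Ω → ℝ),
              Smoluchowski.IsBrownianParticleSystem ξ W lam P →
              ∀ Hhat : Ω → ℝ → ℝ,
                ((Hhat = fun ω => Smoluchowski.corrEstimator (Smoluchowski.meanCount lam r) T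
                    (Smoluchowski.count ξ W r σ ω)) ∨
                  (Hhat = fun ω => Smoluchowski.corrEstimatorPos (Smoluchowski.meanCount lam r) T
                    (Smoluchowski.count ξ W r σ ω))) →
                MemLp (fun ω => Smoluchowski.sigmaEstimator r (Hhat ω)
                    (Smoluchowski.tauStar r σbar T) - σ) 2 P ∧
                ∫ ω, |Smoluchowski.sigmaEstimator r (Hhat ω)
                    (Smoluchowski.tauStar r σbar T) - σ| ^ 2 ∂P
                  ≤ c * (1 + 1 / Smoluchowski.meanCount lam r) * (r / σ) *
                    (σbar ^ 2 * Real.log T / √T) := by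
  -- In the constant, `32π` comes from the variance and `1` from the bias. The three thresholds
  -- ensure `ln T ≥ 1`, `τ_* ≤ T/2` and a negligible squared bias.
  refine ⟨32 * Real.pi + 1, by positivity, fun r σbar hr hsb =>
    ⟨max (Real.exp 1) (max (8 * r ^ 2 / σbar ^ 2) ((2 * σbar / r) ^ 2)), ?_⟩⟩
  intro T hT σ lam hσ hσbar hlam Ω _ P _ ξ W h Hhat hH
  obtain ⟨hT1, hT'⟩ := max_le_iff.1 hT
  obtain ⟨hT2, hT3⟩ := max_le_iff.1 hT'
  have hT0 : 0 < T := (Real.exp_pos 1).trans_le hT1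
  obtain ⟨hτ, hτT⟩ := Smoluchowski.tauStar_bounds hr hsb hT1 hT2
  have hR := (h.covEstimator_error hr hσ hτ.le hT0 hτT).1.aestronglyMeasurable
  have hRm : AEStronglyMeasurable (fun ω => Smoluchowski.covEstimator
      (Smoluchowski.meanCount lam r) T (Smoluchowski.count ξ W r σ ω)
      (Smoluchowski.tauStar r σbar T)) P := by
    refine (hR.add (aestronglyMeasurable_const (b := lam * Smoluchowski.overlap r σ
      (Smoluchowski.tauStar r σbar T).toNNReal))).congr (ae_of_all _ fun ω => ?_)
    simp only [Pi.add_apply, sub_add_cancel]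
  rcases hH with rfl | rfl
  · exact h.sigmaEstimator_error hr hσ hσbar hlam hT1 hT2 hT3 hRm (fun ω => le_rfl)
      (fun ω => rfl)
  · refine h.sigmaEstimator_error hr hσ hσbar hlam hT1 hT2 hT3
      (hRm.sup aestronglyMeasurable_const) (fun ω => ?_) (fun ω => rfl)
    -- Truncation at `0` is a contraction fixing the nonnegative true covariance, so it cannot
    -- increase the error.
    have h0 : 0 ≤ lam * Smoluchowski.overlap r σ (Smoluchowski.tauStar r σbar T).toNNReal :=
      mul_nonneg lam.2 (Smoluchowski.overlap_nonneg _ _ _)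
    have := abs_max_sub_max_le_abs (Smoluchowski.covEstimator
      (Smoluchowski.meanCount lam r) T (Smoluchowski.count ξ W r σ ω)
      (Smoluchowski.tauStar r σbar T))
      (lam * Smoluchowski.overlap r σ (Smoluchowski.tauStar r σbar T).toNNReal) 0
    rwa [max_eq_left h0] at this
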